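/- **Optimality of $2\pi/n$.** Let $n \ge 1$ and let $Y$ be a non-empty smooth manifold (Hausdorff, second countable, without boundary, compact or not, not necessarily connected) of dimension $n-1$, and let $0 < \varepsilon < 2\pi/n$. Then the $n$-dimensional manifold with boundary $V = Y \times [-1,1]$ carries a smooth Riemannian metric $g$ (smooth up to the boundary) whose scalar curvature satisfies $Sc(g) \ge n(n-1)$ everywhere on $V$, and for which the $g$-distance between $Y \times \{-1\}$ and $Y \times \{1\}$, i.e. the infimum of the $g$-lengths of curves in $V$ joining them, is equal to $2\pi/n - \varepsilon$. Here the scalar curvature is normalised so that the unit sphere $S^n$ has $Sc = n(n-1)$. -/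

import Mathlib

open Set
open scoped Manifold ContDiff ENNReal Bundle

noncomputable section

/-! ### Curvature of a metric in coordinates

`S` is the domain of the coordinates (a set with unique derivatives, such as an open set or a
half-space), `b` a basis of the coordinate space and `G u i j` are the metric coefficients
`g_ij` at `u` with respect to `b`. -/

section Coordinates

/-- The partial derivative `∂ₖ f` at `u`, in the direction of the `k`-th basis vector. -/
def coordDeriv {ι E : Type*} [NormedAddCommGroup E] [NormedSpace ℝ E]
    (b : Module.Basis ι ℝ E) (S : Set E) (f : E → ℝ) (k : ι) (u : E) : ℝ :=
  fderivWithin ℝ f S u (b k)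

/-- The Christoffel symbol
`Γᵏᵢⱼ = ½ ∑ₗ gᵏˡ (∂ᵢ gⱼₗ + ∂ⱼ gᵢₗ - ∂ₗ gᵢⱼ)`. -/
def christoffel {ι E : Type*} [Fintype ι] [DecidableEq ι] [NormedAddCommGroup E] [NormedSpace ℝ E]
    (b : Module.Basis ι ℝ E) (S : Set E) (G : E → Matrix ι ι ℝ) (k i j : ι) (u : E) : ℝ :=
  (1 / 2) * ∑ l, (G u)⁻¹ k l *
    (coordDeriv b S (fun v => G v j l) i u + coordDeriv b S (fun v => G v i l) j u
      - coordDeriv b S (fun v => G v i j) l u)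

/-- The Ricci tensor
`Rᵢⱼ = ∑ₖ (∂ₖ Γᵏᵢⱼ - ∂ⱼ Γᵏᵢₖ) + ∑ₖₗ (Γᵏₖₗ Γˡᵢⱼ - Γᵏⱼₗ Γˡᵢₖ)`. -/
def coordRicci {ι E : Type*} [Fintype ι] [DecidableEq ι] [NormedAddCommGroup E] [NormedSpace ℝ E]
    (b : Module.Basis ι ℝ E) (S : Set E) (G : E → Matrix ι ι ℝ) (i j : ι) (u : E) : ℝ :=
  (∑ k, (coordDeriv b S (christoffel b S G k i j) k u
      - coordDeriv b S (christoffel b S G k i k) j u))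
    + ∑ k, ∑ l, (christoffel b S G k k l u * christoffel b S G l i j u
      - christoffel b S G k j l u * christoffel b S G l i k u)

/-- The scalar curvature `∑ᵢⱼ gⁱʲ Rᵢⱼ`; it is `n (n - 1)` on the unit `n`-sphere. -/
def coordScalarCurvature {ι E : Type*} [Fintype ι] [DecidableEq ι] [NormedAddCommGroup E]
    [NormedSpace ℝ E] (b : Module.Basis ι ℝ E) (S : Set E) (G : E → Matrix ι ι ℝ) (u : E) : ℝ :=
  ∑ i, ∑ j, (G u)⁻¹ i j * coordRicci b S G i j u

end Coordinates

/-! ### Riemannian manifolds, possibly with boundary -/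

section Riemannian

/-- Smooth Riemannian metrics on a manifold `M` modelled on `I`. -/
abbrev SmoothMetric {E H : Type*} [NormedAddCommGroup E] [NormedSpace ℝ E] [TopologicalSpace H]
    (I : ModelWithCorners ℝ E H) (M : Type*) [TopologicalSpace M] [ChartedSpace H M]
    [IsManifold I ∞ M] : Type _ :=
  Bundle.ContMDiffRiemannianMetric I ∞ E (fun x : M => TangentSpace I x)

variable {E H M : Type*} [NormedAddCommGroup E] [NormedSpace ℝ E] [TopologicalSpace H]
  {I : ModelWithCorners ℝ E H} [TopologicalSpace M] [ChartedSpace H M] [IsManifold I ∞ M]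

/-- The coefficients of `g` in the chart at `x`: the pullback of `g` under the inverse of the
chart, evaluated on pairs of vectors of the basis `b`. -/
def SmoothMetric.chartCoeff {ι : Type*} (g : SmoothMetric I M) (b : Module.Basis ι ℝ E)
    (x : M) (u : E) : Matrix ι ι ℝ :=
  Matrix.of fun i j => g.inner ((extChartAt I x).symm u)
    (mfderivWithin 𝓘(ℝ, E) I (extChartAt I x).symm (range I) u (b i))
    (mfderivWithin 𝓘(ℝ, E) I (extChartAt I x).symm (range I) u (b j))

/-- The scalar curvature of `g` at `x`, computed in the chart at `x` with respect to the coordinates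
given by the basis `b` of the model space. Derivatives are taken within the range of the model
with corners, hence are one-sided at boundary points. -/
def SmoothMetric.scalarCurvature {ι : Type*} [Fintype ι] [DecidableEq ι] (g : SmoothMetric I M)
    (b : Module.Basis ι ℝ E) (x : M) : ℝ :=
  coordScalarCurvature b (range I) (g.chartCoeff b x) (extChartAt I x x)

/-- The Riemannian distance of `g`: the infimum of the `g`-lengths of `C¹` paths. -/
def SmoothMetric.edist (g : SmoothMetric I M) (x y : M) : ℝ≥0∞ :=
  letI : Bundle.RiemannianBundle (fun x : M => TangentSpace I x) := ⟨g.toRiemannianMetric⟩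
  Manifold.riemannianEDist I x y

/-- The `g`-distance between two subsets of `M`. -/
def SmoothMetric.setEDist (g : SmoothMetric I M) (A B : Set M) : ℝ≥0∞ :=
  ⨅ x ∈ A, ⨅ y ∈ B, g.edist x y

end Riemannian

/-! ### The interval `[-1, 1]` and the band `Y × [-1, 1]` -/

instance factNegOneLtOne : Fact ((-1 : ℝ) < 1) := ⟨by norm_num⟩

/-- The standard basis of the model space of an `m`-manifold times an interval. -/
def bandBasis (m : ℕ) :
    Module.Basis (Fin m ⊕ Fin 1) ℝ (EuclideanSpace ℝ (Fin m) × EuclideanSpace ℝ (Fin 1)) :=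
  (EuclideanSpace.basisFun (Fin m) ℝ).toBasis.prod (EuclideanSpace.basisFun (Fin 1) ℝ).toBasis

end

/-!
The metric on `Y × [-1, 1]` is a warped product. Put `ℓ = 2π/n - ε`. If `h` is a metric on `Y` and
`x = ℓ s / 2` is the arc length in the direction of the interval, then the metric `dx² + f(x) h` has
scalar curvature `Sc(h) / f - m (2 L' + n L²)`, where `m = n - 1` and `L = f' / (2 f)`. For
`f(x) = cos (a x) ^ (4 / n)` one has `L = -(2 a / n) tan (a x)`, which solves the Riccati equation
`2 L' + n L² = -4 a² / n`, so the interval contributes the constant `4 m a² / n`. This exceeds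
`n m = n (n - 1)` as soon as `a > n / 2`, and `f` is positive on the whole interval as long as
`a ℓ < π`; since `ℓ < 2π/n`, there is room for such an `a`. The excess absorbs the term `Sc(h) / f`,
provided that `Sc(h)` is bounded below by a sufficiently small negative constant. In the file the
interval is parametrized by `s ∈ [-1, 1]`, and `k = a ℓ / 2`.

A metric `h` with `Sc(h) ≥ -δ` exists on every `Y`, compact or not
(`exists_metric_neg_le_scalarCurvature`). The scalar curvature of `v⁻² h₀` is a quadratic form in
the 2-jet of `v`, with coefficients depending on `h₀`
(`coordScalarCurvature_conformal`, `exists_abs_conformalScalar_le`). Taking for `v` a locally finite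
sum of bump functions with rapidly decreasing weights makes this jet as small as needed in each of
the charts. As the scalar curvature at a point is defined by the chart at that point, the argument
requires its independence of the chart (`SmoothMetric.scalarCurvature_eq_chart`), which comes from
the tensorial behaviour of the curvature under changes of coordinates
(`coordScalarCurvature_pullback`).

The curvature of the warped product is computed in coordinates
(`coordScalarCurvature_warpedCoeff`); the charts of `[-1, 1]` are affine up to orientation, so in
product charts the metric is the restriction to a half-space of a warped product defined on an open
set, and one-sided derivatives are ordinary ones (`SmoothMetric.scalarCurvature_band`). Finally, the
function `ℓ s / 2` is `1`-Lipschitz, and vertical segments have length `ℓ`, so the boundary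
components lie at distance exactly `ℓ` (`SmoothMetric.setEDist_band`).
-/

noncomputable section

set_option maxSynthPendingDepth 3

/-! ### Smooth fields of bilinear forms -/

section Tensor
open Bundle Topology

variable {E H M : Type*} [NormedAddCommGroup E] [NormedSpace ℝ E] [TopologicalSpace H]
  {I : ModelWithCorners ℝ E H} [TopologicalSpace M] [ChartedSpace H M]

/-- In finite dimension a positive definite form is bounded below on the unit sphere, so its unit
ball is bounded. -/
lemma isVonNBounded_of_pos [FiniteDimensional ℝ E] (B : E →L[ℝ] E →L[ℝ] ℝ)
    (hB : ∀ v, v ≠ 0 → 0 < B v v) : Bornology.IsVonNBounded ℝ {v : E | B v v < 1} := by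
  have hprop : ProperSpace E := FiniteDimensional.proper ℝ E
  have hc : Continuous fun v => B v v := by fun_prop
  obtain ⟨c, hc0, hcb⟩ : ∃ c > 0, ∀ v ∈ Metric.sphere (0 : E) 1, c ≤ B v v := by
    rcases (Metric.sphere (0 : E) 1).eq_empty_or_nonempty with h | h
    · exact ⟨1, one_pos, by simp [h]⟩
    · obtain ⟨v, hv, hmin⟩ := (isCompact_sphere (0 : E) 1).exists_isMinOn h hc.continuousOn
      refine ⟨B v v, hB v ?_, fun w hw => hmin hw⟩
      rintro rfl
      simp at hv
  rw [NormedSpace.isVonNBounded_iff, isBounded_iff_forall_norm_le]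
  refine ⟨√(1 / c), fun v hv => ?_⟩
  rcases eq_or_ne v 0 with rfl | h0
  · simp
  have h1 := hcb (‖v‖⁻¹ • v) (by simp [norm_smul, h0])
  simp only [map_smul, smul_apply, smul_eq_mul] at h1
  have hv' : B v v < 1 := hv
  have hn : 0 < ‖v‖ := norm_pos_iff.2 h0
  apply Real.le_sqrt_of_sq_le
  rw [le_div_iff₀ hc0]
  have : ‖v‖ ^ 2 * c ≤ ‖v‖ ^ 2 * (‖v‖⁻¹ * (‖v‖⁻¹ * B v v)) := by gcongr
  have e : ‖v‖ ^ 2 * (‖v‖⁻¹ * (‖v‖⁻¹ * B v v)) = B v v := by field_simp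
  linarith

lemma isVonNBounded_tangentSpace_of_pos [FiniteDimensional ℝ E] (x : M)
    (B : TangentSpace I x →L[ℝ] TangentSpace I x →L[ℝ] ℝ) (hB : ∀ v, v ≠ 0 → 0 < B v v) :
    Bornology.IsVonNBounded ℝ {v : TangentSpace I x | B v v < 1} :=
  isVonNBounded_of_pos (E := E) B hB

variable [IsManifold I ∞ M]

/-- The inverse of the trivialization of the tangent bundle given by the chart at `x₀`, as a map
from the model space to the tangent space at `x`. -/
abbrev frameMap (I : ModelWithCorners ℝ E H) [IsManifold I ∞ M] (x₀ x : M) :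
    E →L[ℝ] TangentSpace I x :=
  haveI : IsManifold I 1 M := .of_le (n := ∞) (by exact_mod_cast le_top)
  (trivializationAt E (TangentSpace I) x₀).symmL ℝ x

/-- A bilinear form on a finite-dimensional space is assembled smoothly from its coefficients. -/
lemma contMDiffAt_bilin_of_apply [FiniteDimensional ℝ E] {E' H' M' : Type*} [NormedAddCommGroup E']
    [NormedSpace ℝ E'] [TopologicalSpace H'] {I' : ModelWithCorners ℝ E' H'} [TopologicalSpace M']
    [ChartedSpace H' M']
    {B : M' → E →L[ℝ] E →L[ℝ] ℝ} {x : M'}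
    (h : ∀ v w, ContMDiffAt I' 𝓘(ℝ) ∞ (fun y => B y v w) x) :
    ContMDiffAt I' 𝓘(ℝ, E →L[ℝ] E →L[ℝ] ℝ) ∞ B x := by
  let b := Module.finBasis ℝ E
  have key : B = fun y => ∑ i, ∑ j, B y (b i) (b j) •
      ((b.coord i).toContinuousLinearMap.smulRight (b.coord j).toContinuousLinearMap) := by
    funext y
    ext v w
    simp only [sum_apply, smul_apply,
      ContinuousLinearMap.smulRight_apply, LinearMap.coe_toContinuousLinearMap', smul_eq_mul]
    conv_lhs => rw [← b.sum_repr v, ← b.sum_repr w]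
    simp only [map_sum, map_smul, sum_apply, smul_apply,
      smul_eq_mul, Finset.mul_sum, Module.Basis.coord_apply]
    rw [Finset.sum_comm]
    refine Finset.sum_congr rfl fun i _ => Finset.sum_congr rfl fun j _ => by ring
  rw [key]
  refine contMDiffAt_finsetSum fun i _ => contMDiffAt_finsetSum fun j _ => ?_
  exact (h _ _).smul contMDiffAt_const

lemma trivializationAt_bilin_apply (x₀ x : M) (hx : x ∈ (chartAt H x₀).source)
    (B : TangentSpace I x →L[ℝ] TangentSpace I x →L[ℝ] ℝ) (v w : E) :
    (trivializationAt (E →L[ℝ] E →L[ℝ] ℝ)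
      (fun x : M => TangentSpace I x →L[ℝ] TangentSpace I x →L[ℝ] ℝ) x₀ ⟨x, B⟩).2 v w
      = B (frameMap I x₀ x v) (frameMap I x₀ x w) := by
  have hx' : x ∈ (trivializationAt E (TangentSpace I) x₀).baseSet := by simpa using hx
  rw [hom_trivializationAt_apply]
  rw [inCoordinates_apply_eq₂ hx' hx' (by simp)]
  simp only [frameMap, Trivialization.symmL_apply _ hx']
  simp

set_option synthInstance.maxHeartbeats 200000 in
/-- A field of bilinear forms is smooth if and only if its coefficients in the frame given by the
chart at `x₀` are. -/
lemma contMDiffAt_bilin_section_iff [FiniteDimensional ℝ E]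
    (B : ∀ x : M, TangentSpace I x →L[ℝ] TangentSpace I x →L[ℝ] ℝ) (x₀ x : M)
    (hx : x ∈ (chartAt H x₀).source) :
    ContMDiffAt I (I.prod 𝓘(ℝ, E →L[ℝ] E →L[ℝ] ℝ)) ∞
      (fun x => TotalSpace.mk' (E →L[ℝ] E →L[ℝ] ℝ) x (B x)) x ↔
    ∀ v w, ContMDiffAt I 𝓘(ℝ) ∞ (fun x => B x (frameMap I x₀ x v) (frameMap I x₀ x w)) x := by
  have hn : (chartAt H x₀).source ∈ 𝓝 x := (chartAt H x₀).open_source.mem_nhds hx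
  rw [(trivializationAt (E →L[ℝ] E →L[ℝ] ℝ)
      (fun x : M => TangentSpace I x →L[ℝ] TangentSpace I x →L[ℝ] ℝ) x₀).contMDiffAt_section_iff
        (by simpa using hx)]
  constructor
  · intro h v w
    have h1 := (h.clm_apply (contMDiffAt_const (c := v))).clm_apply (contMDiffAt_const (c := w))
    refine h1.congr_of_eventuallyEq ?_
    filter_upwards [hn] with y hy
    rw [trivializationAt_bilin_apply x₀ y hy]
  · intro h
    refine contMDiffAt_bilin_of_apply fun v w => (h v w).congr_of_eventuallyEq ?_
    filter_upwards [hn] with y hy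
    rw [trivializationAt_bilin_apply x₀ y hy]

lemma chartCoeff_apply {ι : Type*} (g : SmoothMetric I M) (b : Module.Basis ι ℝ E) (x₀ x : M)
    (hx : x ∈ (chartAt H x₀).source) (i j : ι) :
    g.chartCoeff b x₀ (extChartAt I x₀ x) i j =
      g.inner x (frameMap I x₀ x (b i)) (frameMap I x₀ x (b j)) := by
  have : IsManifold I 1 M := .of_le (n := ∞) (by exact_mod_cast le_top)
  simp only [SmoothMetric.chartCoeff, Matrix.of_apply]
  rw [← TangentBundle.symmL_trivializationAt (I := I) hx]
  have e : (extChartAt I x₀).symm (extChartAt I x₀ x) = x :=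
    (extChartAt I x₀).left_inv (by simpa using hx)
  rw [e]
  rfl

lemma frameMap_injective {x₀ x : M} (hx : x ∈ (chartAt H x₀).source) :
    Function.Injective (frameMap I x₀ x) := by
  have : IsManifold I 1 M := .of_le (n := ∞) (by exact_mod_cast le_top)
  have hx' : x ∈ (trivializationAt E (TangentSpace I) x₀).baseSet := by simpa using hx
  exact Function.LeftInverse.injective
    (g := (trivializationAt E (TangentSpace I) x₀).continuousLinearMapAt ℝ x)
    fun v => (trivializationAt E (TangentSpace I) x₀).continuousLinearMapAt_symmL hx' v

/-- The Euclidean inner product of the coordinates, in the chart at `x₀`, of tangent vectors at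
`x`. -/
def coordinateForm {E : Type*} [NormedAddCommGroup E] [InnerProductSpace ℝ E]
    (I : ModelWithCorners ℝ E H) [IsManifold I ∞ M] (x₀ x : M) :
    TangentSpace I x →L[ℝ] TangentSpace I x →L[ℝ] ℝ :=
  haveI : IsManifold I 1 M := .of_le (n := ∞) (by exact_mod_cast le_top)
  letI A : E →L[ℝ] E := (trivializationAt E (TangentSpace I) x₀).continuousLinearMapAt ℝ x
  ((innerSL ℝ (E := E)).bilinearComp A A : E →L[ℝ] E →L[ℝ] ℝ)

set_option synthInstance.maxHeartbeats 200000 in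
/-- Every smooth σ-compact manifold carries a smooth Riemannian metric. -/
theorem nonempty_smoothMetric {E : Type*} [NormedAddCommGroup E] [InnerProductSpace ℝ E]
    {I : ModelWithCorners ℝ E H} [IsManifold I ∞ M]
    [FiniteDimensional ℝ E] [T2Space M] [SigmaCompactSpace M] :
    Nonempty (SmoothMetric I M) := by
  have : IsManifold I 1 M := .of_le (n := ∞) (by exact_mod_cast le_top)
  obtain ⟨s, hs⟩ := exists_contMDiffSection_forall_mem_convex_of_local (n := (⊤ : ℕ∞)) I
    (F_fiber := E →L[ℝ] E →L[ℝ] ℝ)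
    (fun x : M => TangentSpace I x →L[ℝ] TangentSpace I x →L[ℝ] ℝ)
    (fun x => {B | (∀ v w, B v w = B w v) ∧ ∀ v, v ≠ 0 → 0 < B v v})
    (by
      intro x B hB B' hB' a c ha hc hac
      refine ⟨fun v w => by simp [hB.1 v w, hB'.1 v w], fun v hv => ?_⟩
      have h1 := hB.2 v hv
      have h2 := hB'.2 v hv
      simp only [add_apply, smul_apply, smul_eq_mul]
      rcases ha.eq_or_lt with rfl | ha
      · have : c = 1 := by linarith
        simp [this, h2]
      · positivity)
    (by
      intro x₀
      -- Near `x₀` the Euclidean inner product of the coordinate vectors is such a form.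
      let e := trivializationAt E (TangentSpace I : M → Type _) x₀
      have happ : ∀ x v w, coordinateForm I x₀ x v w =
        inner ℝ (e.continuousLinearMapAt ℝ x v) (e.continuousLinearMapAt ℝ x w) :=
        fun _ _ _ => rfl
      refine ⟨(chartAt H x₀).source, (chartAt H x₀).open_source.mem_nhds (mem_chart_source H x₀),
        coordinateForm I x₀, ?_, ?_⟩
      · intro x hx
        refine ContMDiffAt.contMDiffWithinAt ?_
        rw [contMDiffAt_bilin_section_iff _ x₀ x hx]
        intro v w
        refine (contMDiffAt_const (c := inner ℝ v w)).congr_of_eventuallyEq ?_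
        filter_upwards [(chartAt H x₀).open_source.mem_nhds hx] with y hy
        have hy' : y ∈ e.baseSet := by simpa [e] using hy
        have key : ∀ v, e.continuousLinearMapAt ℝ y (frameMap I x₀ y v) = v := fun v =>
          e.continuousLinearMapAt_symmL hy' v
        simp [happ, key]
      · intro x hx
        have hx' : x ∈ e.baseSet := by simpa [e] using hx
        refine ⟨fun v w => by simp [happ, real_inner_comm], fun v hv => ?_⟩
        rw [happ, real_inner_self_eq_norm_sq]
        have : e.continuousLinearMapAt ℝ x v ≠ 0 := by
          intro h
          apply hv
          have := e.symmL_continuousLinearMapAt (R := ℝ) hx' v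
          rw [← this, h, map_zero]
        positivity)
  exact ⟨{  inner := s
            symm := fun x => (hs x).1
            pos := fun x => (hs x).2
            isVonNBounded := fun x => isVonNBounded_tangentSpace_of_pos x (s x) (hs x).2
            contMDiff := s.contMDiff }⟩

/-- The metric `v⁻² g` conformal to `g`. -/
def SmoothMetric.conformal [FiniteDimensional ℝ E] (g : SmoothMetric I M) (v : M → ℝ)
    (hv : ContMDiff I 𝓘(ℝ) ∞ v) (hv0 : ∀ x, 0 < v x) : SmoothMetric I M where
  inner x := (v x ^ 2)⁻¹ • g.inner x
  symm x u w := by simp [g.symm x u w]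
  pos x u hu := by
    have h1 := g.pos x u hu
    have h2 := hv0 x
    simp only [smul_apply, smul_eq_mul]
    positivity
  isVonNBounded x := by
    refine isVonNBounded_tangentSpace_of_pos x ((v x ^ 2)⁻¹ • g.inner x) fun u hu => ?_
    have h1 := g.pos x u hu
    have h2 := hv0 x
    simp only [smul_apply, smul_eq_mul]
    exact mul_pos (by positivity) h1
  contMDiff := by
    refine ContMDiff.smul_section (s := fun x => g.inner x) (f := fun x => (v x ^ 2)⁻¹) ?_ g.contMDiff
    exact (hv.pow 2).inv₀ fun x => (pow_pos (hv0 x) 2).ne'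

lemma SmoothMetric.contDiffOn_chartCoeff [FiniteDimensional ℝ E] [I.Boundaryless] {ι : Type*}
    (g : SmoothMetric I M) (b : Module.Basis ι ℝ E) (x₀ : M) (i j : ι) :
    ContDiffOn ℝ ∞ (fun u => g.chartCoeff b x₀ u i j) (extChartAt I x₀).target := by
  rw [← contMDiffOn_iff_contDiffOn]
  have h : ContMDiffOn I 𝓘(ℝ) ∞
      (fun x => g.inner x (frameMap I x₀ x (b i)) (frameMap I x₀ x (b j)))
      (chartAt H x₀).source := fun x hx =>
    ((contMDiffAt_bilin_section_iff g.inner x₀ x hx).1 (g.contMDiff x) _ _).contMDiffWithinAt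
  refine (h.comp (contMDiffOn_extChartAt_symm (n := ∞) x₀) ?_).congr ?_
  · intro u hu
    simpa using (extChartAt I x₀).map_target hu
  · intro u hu
    have hx : (extChartAt I x₀).symm u ∈ (chartAt H x₀).source := by
      simpa using (extChartAt I x₀).map_target hu
    have := chartCoeff_apply g b x₀ _ hx i j
    rw [(extChartAt I x₀).right_inv hu] at this
    exact this

end Tensor

/-! ### Calculus of metric coefficients in coordinates -/

section CoordinateCalculus
open Topology Filter

variable {ι E : Type*} [NormedAddCommGroup E] [NormedSpace ℝ E] (b : Module.Basis ι ℝ E)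

lemma coordDeriv_univ (f : E → ℝ) (k : ι) (u : E) :
    coordDeriv b univ f k u = fderiv ℝ f u (b k) := by
  rw [coordDeriv, fderivWithin_univ]

lemma coordDeriv_congr {S : Set E} {f f' : E → ℝ} {u : E} (hu : u ∈ S) (h : f =ᶠ[𝓝[S] u] f')
    (k : ι) : coordDeriv b S f k u = coordDeriv b S f' k u := by
  rw [coordDeriv, coordDeriv, h.fderivWithin_eq (h.self_of_nhdsWithin hu)]

lemma coordDeriv_eventuallyEq {S : Set E} {f f' : E → ℝ} {u : E} (h : f =ᶠ[𝓝[S] u] f') (k : ι) :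
    coordDeriv b S f k =ᶠ[𝓝[S] u] coordDeriv b S f' k := by
  filter_upwards [eventually_eventually_nhdsWithin.2 h, self_mem_nhdsWithin] with x hx hxS
  exact coordDeriv_congr b hxS hx k

lemma HasFDerivAt.coordDeriv_eq {f : E → ℝ} {f' : E →L[ℝ] ℝ} {u : E} (h : HasFDerivAt f f' u)
    (k : ι) : coordDeriv b univ f k u = f' (b k) := by
  rw [coordDeriv_univ, h.fderiv]

lemma contDiffOn_coordDeriv {U : Set E} (hU : IsOpen U) {f : E → ℝ} (hf : ContDiffOn ℝ ∞ f U)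
    (k : ι) : ContDiffOn ℝ ∞ (coordDeriv b univ f k) U := by
  have h : ContDiffOn ℝ ∞ (fun u => fderiv ℝ f u (b k)) U :=
    (hf.fderiv_of_isOpen hU (by norm_cast)).clm_apply contDiffOn_const
  exact h.congr fun u _ => coordDeriv_univ b f k u

variable [Fintype ι] [DecidableEq ι]

lemma christoffel_eventuallyEq {S : Set E} {G G' : E → Matrix ι ι ℝ} {u : E}
    (h : G =ᶠ[𝓝[S] u] G') (k i j : ι) :
    christoffel b S G k i j =ᶠ[𝓝[S] u] christoffel b S G' k i j := by
  have hd : ∀ i j l, coordDeriv b S (fun v => G v i j) l =ᶠ[𝓝[S] u]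
      coordDeriv b S (fun v => G' v i j) l := fun i j l =>
    coordDeriv_eventuallyEq b (h.mono fun x hx => by simp only [hx]) l
  have hall : ∀ᶠ x in 𝓝[S] u, ∀ i j l, coordDeriv b S (fun v => G v i j) l x =
      coordDeriv b S (fun v => G' v i j) l x := by
    simp only [eventually_all]
    exact hd
  filter_upwards [h, hall] with x hx hx'
  simp only [christoffel, hx, hx']

lemma coordRicci_congr {S : Set E} {G G' : E → Matrix ι ι ℝ} {u : E} (hu : u ∈ S)
    (h : G =ᶠ[𝓝[S] u] G') (i j : ι) : coordRicci b S G i j u = coordRicci b S G' i j u := by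
  have hc := fun k i j => christoffel_eventuallyEq b h k i j
  have hc' := fun k i j => (hc k i j).self_of_nhdsWithin hu
  have hd := fun k i j l => coordDeriv_congr b hu (hc k i j) l
  simp only [coordRicci, hc', hd]

/-- The scalar curvature at a point depends only on the germ of the metric coefficients. -/
lemma coordScalarCurvature_congr {S : Set E} {G G' : E → Matrix ι ι ℝ} {u : E} (hu : u ∈ S)
    (h : G =ᶠ[𝓝[S] u] G') : coordScalarCurvature b S G u = coordScalarCurvature b S G' u := by
  simp only [coordScalarCurvature, coordRicci_congr b hu h, h.self_of_nhdsWithin hu]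

lemma contDiffOn_det {U : Set E} {G : E → Matrix ι ι ℝ}
    (hG : ∀ i j, ContDiffOn ℝ ∞ (fun u => G u i j) U) : ContDiffOn ℝ ∞ (fun u => (G u).det) U := by
  simp only [Matrix.det_apply]
  exact ContDiffOn.sum fun σ _ => (contDiffOn_prod fun i _ => hG _ _).const_smul _

lemma contDiffOn_inv_apply {U : Set E} {G : E → Matrix ι ι ℝ}
    (hG : ∀ i j, ContDiffOn ℝ ∞ (fun u => G u i j) U) (hdet : ∀ u ∈ U, (G u).det ≠ 0) (i j : ι) :
    ContDiffOn ℝ ∞ (fun u => (G u)⁻¹ i j) U := by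
  have hadj : ContDiffOn ℝ ∞ (fun u => (G u).adjugate i j) U := by
    simp only [Matrix.adjugate_apply]
    refine contDiffOn_det fun k l => ?_
    by_cases hk : k = j
    · subst hk
      simpa using contDiffOn_const
    · simpa [Matrix.updateRow_ne hk] using hG k l
  refine (((contDiffOn_det hG).inv hdet).mul hadj).congr fun u _ => ?_
  simp [Matrix.inv_def, Ring.inverse_eq_inv]

lemma contDiffOn_christoffel {U : Set E} (hU : IsOpen U) {G : E → Matrix ι ι ℝ}
    (hG : ∀ i j, ContDiffOn ℝ ∞ (fun u => G u i j) U) (hdet : ∀ u ∈ U, (G u).det ≠ 0)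
    (k i j : ι) : ContDiffOn ℝ ∞ (christoffel b univ G k i j) U := by
  refine contDiffOn_const.mul (ContDiffOn.sum fun l _ => (contDiffOn_inv_apply hG hdet k l).mul ?_)
  exact ((contDiffOn_coordDeriv b hU (hG _ _) _).add (contDiffOn_coordDeriv b hU (hG _ _) _)).sub
    (contDiffOn_coordDeriv b hU (hG _ _) _)

end CoordinateCalculus

/-! ### Invariance of the scalar curvature under changes of coordinates -/

section Invariance
open Topology Filter

variable {ι E : Type*} [NormedAddCommGroup E] [NormedSpace ℝ E]

/-- The matrix of a bilinear form in a basis. -/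
def gramMatrix (b : Module.Basis ι ℝ E) (B : E →L[ℝ] E →L[ℝ] ℝ) : Matrix ι ι ℝ :=
  Matrix.of fun i j => B (b i) (b j)

lemma gramMatrix_apply (b : Module.Basis ι ℝ E) (B : E →L[ℝ] E →L[ℝ] ℝ) (i j : ι) :
    gramMatrix b B i j = B (b i) (b j) := rfl

/-- The curvature `x ↦ R(x, v) w` of the connection with Christoffel symbols `Γ`. -/
def curvatureMap (Γ : E → E →L[ℝ] E →L[ℝ] E) (u v w : E) : E →L[ℝ] E :=
  ((fderiv ℝ Γ u).flip v).flip w - (fderiv ℝ Γ u v).flip w + (Γ u).flip (Γ u v w)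
    - (Γ u v).comp ((Γ u).flip w)

lemma curvatureMap_apply (Γ : E → E →L[ℝ] E →L[ℝ] E) (u v w x : E) :
    curvatureMap Γ u v w x = fderiv ℝ Γ u x v w - fderiv ℝ Γ u v x w + Γ u x (Γ u v w)
      - Γ u v (Γ u x w) := rfl

/-- Under a change of coordinates `ψ`, with `Γ'` the Christoffel symbols in the source, the
curvature transforms as a tensor: the inhomogeneous terms cancel since the second and the third
derivative of `ψ` are symmetric. -/
lemma fderiv_curvatureMap {ψ : E → E} {U : Set E} (hU : IsOpen U) (hψ : ContDiffOn ℝ ∞ ψ U)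
    {Γ Γ' : E → E →L[ℝ] E →L[ℝ] E} {u : E} (hu : u ∈ U) (hΓ : DifferentiableAt ℝ Γ (ψ u))
    (hΓ' : DifferentiableAt ℝ Γ' u)
    (h : ∀ x ∈ U, ∀ v w, fderiv ℝ ψ x (Γ' x v w) =
      Γ (ψ x) (fderiv ℝ ψ x v) (fderiv ℝ ψ x w) + fderiv ℝ (fderiv ℝ ψ) x v w) (v w x : E) :
    fderiv ℝ ψ u (curvatureMap Γ' u v w x) =
      curvatureMap Γ (ψ u) (fderiv ℝ ψ u v) (fderiv ℝ ψ u w) (fderiv ℝ ψ u x) := by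
  have hJ : ContDiffOn ℝ ∞ (fderiv ℝ ψ) U := hψ.fderiv_of_isOpen hU (by norm_cast)
  have hJ2 : ContDiffOn ℝ ∞ (fderiv ℝ (fderiv ℝ ψ)) U := hJ.fderiv_of_isOpen hU (by norm_cast)
  have hUn := hU.mem_nhds hu
  have dψ := ((hψ.contDiffAt hUn).differentiableAt (by simp)).hasFDerivAt
  have dJ := ((hJ.contDiffAt hUn).differentiableAt (by simp)).hasFDerivAt
  have dJ2 := ((hJ2.contDiffAt hUn).differentiableAt (by simp)).hasFDerivAt
  have s2 : ∀ v w, fderiv ℝ (fderiv ℝ ψ) u v w = fderiv ℝ (fderiv ℝ ψ) u w v := fun v w =>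
    (hψ.contDiffAt hUn).isSymmSndFDerivAt (by simp; norm_cast) v w
  have s3 : ∀ v w, fderiv ℝ (fderiv ℝ (fderiv ℝ ψ)) u v w =
      fderiv ℝ (fderiv ℝ (fderiv ℝ ψ)) u w v := fun v w =>
    (hJ.contDiffAt hUn).isSymmSndFDerivAt (by simp; norm_cast) v w
  -- Differentiate the transformation law of the Christoffel symbols in the direction `y`.
  have key : ∀ y v w, fderiv ℝ (fderiv ℝ ψ) u y (Γ' u v w) + fderiv ℝ ψ u (fderiv ℝ Γ' u y v w) =
      fderiv ℝ Γ (ψ u) (fderiv ℝ ψ u y) (fderiv ℝ ψ u v) (fderiv ℝ ψ u w)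
      + Γ (ψ u) (fderiv ℝ (fderiv ℝ ψ) u y v) (fderiv ℝ ψ u w)
      + Γ (ψ u) (fderiv ℝ ψ u v) (fderiv ℝ (fderiv ℝ ψ) u y w)
      + fderiv ℝ (fderiv ℝ (fderiv ℝ ψ)) u y v w := by
    intro y v w
    have cv := fun v : E => (hasFDerivAt_const v u : HasFDerivAt (𝕜 := ℝ) (fun _ : E => v) 0 u)
    have l := dJ.clm_apply ((hΓ'.hasFDerivAt.clm_apply (cv v)).clm_apply (cv w))
    have r := ((((hΓ.hasFDerivAt.comp u dψ).clm_apply (dJ.clm_apply (cv v))).clm_apply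
      (dJ.clm_apply (cv w)))).add ((dJ2.clm_apply (cv v)).clm_apply (cv w))
    have he : (fun x => fderiv ℝ ψ x (Γ' x v w)) =ᶠ[𝓝 u] _ :=
      Filter.eventually_of_mem hUn fun x hx => h x hx v w
    have e := congrArg (fun L => L y) (l.unique (r.congr_of_eventuallyEq he))
    simp only [Function.comp_apply, add_apply, ContinuousLinearMap.flip_apply, zero_apply,
      ContinuousLinearMap.comp_apply, map_zero, zero_add] at e
    rw [add_comm, e]
    abel
  have h0 := h u hu
  have kx := key x v w
  have kv := key v x w
  rw [curvatureMap_apply, curvatureMap_apply]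
  simp only [map_sub, map_add, h0]
  rw [s2 x v] at kx
  rw [s3 x v] at kx
  have e1 : fderiv ℝ ψ u (fderiv ℝ Γ' u x v w) = _ := eq_sub_of_add_eq' kx
  have e2 : fderiv ℝ ψ u (fderiv ℝ Γ' u v x w) = _ := eq_sub_of_add_eq' kv
  rw [e1, e2]
  abel

/-- The Ricci tensor `(v, w) ↦ tr (x ↦ R(x, v) w)`. -/
def ricciForm (Γ : E → E →L[ℝ] E →L[ℝ] E) (u v w : E) : ℝ :=
  LinearMap.trace ℝ E (curvatureMap Γ u v w : E →ₗ[ℝ] E)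

lemma ricciForm_add_left (Γ : E → E →L[ℝ] E →L[ℝ] E) (u v v' w : E) :
    ricciForm Γ u (v + v') w = ricciForm Γ u v w + ricciForm Γ u v' w := by
  have : curvatureMap Γ u (v + v') w = curvatureMap Γ u v w + curvatureMap Γ u v' w := by
    ext x
    simp only [curvatureMap_apply, map_add, add_apply]
    abel
  simp only [ricciForm, this, ContinuousLinearMap.toLinearMap_add, map_add]

lemma ricciForm_add_right (Γ : E → E →L[ℝ] E →L[ℝ] E) (u v w w' : E) :
    ricciForm Γ u v (w + w') = ricciForm Γ u v w + ricciForm Γ u v w' := by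
  have : curvatureMap Γ u v (w + w') = curvatureMap Γ u v w + curvatureMap Γ u v w' := by
    ext x
    simp only [curvatureMap_apply, map_add, add_apply]
    abel
  simp only [ricciForm, this, ContinuousLinearMap.toLinearMap_add, map_add]

lemma ricciForm_smul_left (Γ : E → E →L[ℝ] E →L[ℝ] E) (u : E) (c : ℝ) (v w : E) :
    ricciForm Γ u (c • v) w = c * ricciForm Γ u v w := by
  have : curvatureMap Γ u (c • v) w = c • curvatureMap Γ u v w := by
    ext x
    simp only [curvatureMap_apply, map_smul, smul_apply, smul_sub, smul_add]
  simp only [ricciForm, this, ContinuousLinearMap.toLinearMap_smul, map_smul, smul_eq_mul]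

lemma ricciForm_smul_right (Γ : E → E →L[ℝ] E →L[ℝ] E) (u : E) (c : ℝ) (v w : E) :
    ricciForm Γ u v (c • w) = c * ricciForm Γ u v w := by
  have : curvatureMap Γ u v (c • w) = c • curvatureMap Γ u v w := by
    ext x
    simp only [curvatureMap_apply, map_smul, smul_apply, smul_sub, smul_add]
  simp only [ricciForm, this, ContinuousLinearMap.toLinearMap_smul, map_smul, smul_eq_mul]

lemma ricciForm_sum [Fintype ι] (b : Module.Basis ι ℝ E) (Γ : E → E →L[ℝ] E →L[ℝ] E) (u : E)
    (x y : ι → ℝ) :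
    ricciForm Γ u (∑ i, x i • b i) (∑ j, y j • b j) =
      ∑ i, ∑ j, x i * y j * ricciForm Γ u (b i) (b j) := by
  let R : E →ₗ[ℝ] E →ₗ[ℝ] ℝ := LinearMap.mk₂ ℝ (ricciForm Γ u) (ricciForm_add_left Γ u)
    (ricciForm_smul_left Γ u) (ricciForm_add_right Γ u) (ricciForm_smul_right Γ u)
  change R _ _ = ∑ i, ∑ j, x i * y j * R (b i) (b j)
  simp only [map_sum, map_smul, LinearMap.sum_apply, LinearMap.smul_apply, smul_eq_mul,
    Finset.mul_sum]
  rw [Finset.sum_comm]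
  refine Finset.sum_congr rfl fun i _ => Finset.sum_congr rfl fun j _ => by ring

lemma contDiffOn_gramMatrix (b : Module.Basis ι ℝ E) {V : Set E}
    {g : E → E →L[ℝ] E →L[ℝ] ℝ} (hg : ContDiffOn ℝ ∞ g V)
    (i j : ι) : ContDiffOn ℝ ∞ (fun u => gramMatrix b (g u) i j) V :=
  (hg.clm_apply contDiffOn_const).clm_apply contDiffOn_const

lemma basis_induction (b : Module.Basis ι ℝ E) {P : E → Prop} (hb : ∀ i, P (b i)) (h0 : P 0)
    (hadd : ∀ v w, P v → P w → P (v + w)) (hsmul : ∀ (c : ℝ) v, P v → P (c • v)) (v : E) : P v :=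
  Submodule.span_induction (p := fun v _ => P v) (by rintro _ ⟨i, rfl⟩; exact hb i) h0
    (fun x y _ _ => hadd x y) (fun c x _ => hsmul c x)
    (show v ∈ Submodule.span ℝ (range b) by rw [b.span_eq]; trivial)

variable [Fintype ι] [DecidableEq ι] (b : Module.Basis ι ℝ E)

lemma eq_of_gramMatrix_det_ne_zero {B : E →L[ℝ] E →L[ℝ] ℝ} (hB : (gramMatrix b B).det ≠ 0)
    {v w : E} (h : ∀ z, B v z = B w z) : v = w := by
  have h0 : Matrix.vecMul (b.repr (v - w)) (gramMatrix b B) = 0 := by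
    funext j
    have : B (v - w) (b j) = 0 := by simp [h]
    rw [← b.sum_repr (v - w)] at this
    simpa [Matrix.vecMul, dotProduct, gramMatrix, sum_apply] using this
  have := Matrix.eq_zero_of_vecMul_eq_zero hB h0
  have h1 : b.repr (v - w) = 0 := by ext i; exact congrFun this i
  rw [map_eq_zero_iff _ b.repr.injective] at h1
  exact sub_eq_zero.1 h1

lemma christoffel_symm {G : E → Matrix ι ι ℝ} {V : Set E} (hV : IsOpen V)
    (hsymm : ∀ x ∈ V, (G x).IsSymm) (k i j : ι) (u : E) (hu : u ∈ V) :
    christoffel b univ G k i j u = christoffel b univ G k j i u := by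
  have h : ∀ l, coordDeriv b univ (fun x => G x i j) l u =
      coordDeriv b univ (fun x => G x j i) l u := fun l =>
    coordDeriv_congr b (mem_univ u) (by
      rw [nhdsWithin_univ]
      exact Filter.eventually_of_mem (hV.mem_nhds hu) fun x hx => (hsymm x hx).apply j i) l
  simp only [christoffel]
  congr 1
  refine Finset.sum_congr rfl fun l _ => ?_
  rw [h l]
  ring

/-- The Christoffel symbols at `u` as a vector-valued bilinear map,
`(v, w) ↦ ∑ Γᵏᵢⱼ vⁱ wʲ bₖ`. -/
def christoffelMap [FiniteDimensional ℝ E] (G : E → Matrix ι ι ℝ) (u : E) : E →L[ℝ] E →L[ℝ] E :=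
  ∑ k, ∑ i, ∑ j, christoffel b univ G k i j u •
    (b.coord i).toContinuousLinearMap.smulRight
      ((b.coord j).toContinuousLinearMap.smulRight (b k))

variable [FiniteDimensional ℝ E]

lemma christoffelMap_basis (G : E → Matrix ι ι ℝ) (u : E) (i j : ι) :
    christoffelMap b G u (b i) (b j) = ∑ k, christoffel b univ G k i j u • b k := by
  simp [christoffelMap, sum_apply, Finsupp.single_apply, Finset.sum_ite_eq]

lemma coord_christoffelMap_basis (G : E → Matrix ι ι ℝ) (u : E) (k i j : ι) :
    b.coord k (christoffelMap b G u (b i) (b j)) = christoffel b univ G k i j u := by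
  simp [christoffelMap_basis, Finsupp.single_apply]

/-- The Koszul formula, which characterizes the Christoffel symbols. -/
lemma christoffelMap_koszul {g : E → E →L[ℝ] E →L[ℝ] ℝ} {u : E} (hg : DifferentiableAt ℝ g u)
    (hsymm : ∀ v w, g u v w = g u w v) (hdet : (gramMatrix b (g u)).det ≠ 0) (v w z : E) :
    2 * g u (christoffelMap b (fun u => gramMatrix b (g u)) u v w) z =
      fderiv ℝ g u v w z + fderiv ℝ g u w v z - fderiv ℝ g u z v w := by
  revert z w v
  refine basis_induction b (fun i => ?_) (by simp) (fun v v' hv hv' w z => ?_)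
    (fun c v hv w z => ?_)
  · refine basis_induction b (fun j => ?_) (by simp) (fun v v' hv hv' z => ?_)
      (fun c v hv z => ?_)
    · refine basis_induction b (fun m => ?_) (by simp) (fun v v' hv hv' => ?_)
        (fun c v hv => ?_)
      · have hd : ∀ i j k, coordDeriv b univ (fun v => gramMatrix b (g v) i j) k u =
            fderiv ℝ g u (b k) (b i) (b j) := by
          intro i j k
          have h := (hg.hasFDerivAt.clm_apply (hasFDerivAt_const (b i) u)).clm_apply
            (hasFDerivAt_const (b j) u)
          exact (HasFDerivAt.coordDeriv_eq b h k).trans (by simp)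
        rw [christoffelMap_basis]
        simp only [christoffel, map_sum, map_smul, sum_apply, smul_apply, smul_eq_mul, hd]
        have hinv : ∀ l, ∑ k, (gramMatrix b (g u))⁻¹ k l * g u (b k) (b m) =
            if m = l then 1 else 0 := by
          intro l
          have := congrFun (congrFun (Matrix.mul_nonsing_inv (gramMatrix b (g u))
            (isUnit_iff_ne_zero.2 hdet)) m) l
          rw [Matrix.mul_apply, Matrix.one_apply] at this
          rw [← this]
          refine Finset.sum_congr rfl fun k _ => ?_
          rw [gramMatrix_apply, hsymm, mul_comm]
        set T := fun l => fderiv ℝ g u (b i) (b j) (b l) + fderiv ℝ g u (b j) (b i) (b l)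
          - fderiv ℝ g u (b l) (b i) (b j) with hT
        have : 2 * ∑ k, 1 / 2 * (∑ l, (gramMatrix b (g u))⁻¹ k l * T l) * g u (b k) (b m) =
            ∑ l, T l * ∑ k, (gramMatrix b (g u))⁻¹ k l * g u (b k) (b m) := by
          simp only [Finset.mul_sum, Finset.sum_mul]
          rw [Finset.sum_comm]
          refine Finset.sum_congr rfl fun k _ => Finset.sum_congr rfl fun l _ => by ring
        refine this.trans ?_
        simp only [hinv, mul_ite, mul_one, mul_zero, Finset.sum_ite_eq, Finset.mem_univ, if_true,
          hT]
      · simp only [map_add, add_apply] at hv hv' ⊢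
        linarith
      · simp only [map_smul, smul_apply, smul_eq_mul] at hv ⊢
        linear_combination c * hv
    · have h1 := hv z
      have h2 := hv' z
      simp only [map_add, add_apply] at h1 h2 ⊢
      linarith
    · have h1 := hv z
      simp only [map_smul, smul_apply, smul_eq_mul] at h1 ⊢
      linear_combination c * h1
  · have h1 := hv w z
    have h2 := hv' w z
    simp only [map_add, add_apply] at h1 h2 ⊢
    linarith
  · have h1 := hv w z
    simp only [map_smul, smul_apply, smul_eq_mul] at h1 ⊢
    linear_combination c * h1

lemma contDiffOn_christoffelMap {V : Set E} (hV : IsOpen V) {G : E → Matrix ι ι ℝ}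
    (hG : ∀ i j, ContDiffOn ℝ ∞ (fun u => G u i j) V) (hdet : ∀ u ∈ V, (G u).det ≠ 0) :
    ContDiffOn ℝ ∞ (christoffelMap b G) V :=
  ContDiffOn.sum fun k _ => ContDiffOn.sum fun i _ => ContDiffOn.sum fun j _ =>
    (contDiffOn_christoffel b hV hG hdet k i j).smul contDiffOn_const

/-- The Christoffel symbols of a pulled back metric. -/
lemma fderiv_christoffelMap {ψ : E → E} {U V : Set E} (hU : IsOpen U) (hV : IsOpen V)
    (hψ : ContDiffOn ℝ ∞ ψ U) (hUV : MapsTo ψ U V) {g g' : E → E →L[ℝ] E →L[ℝ] ℝ}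
    (hg : ContDiffOn ℝ ∞ g V) (hg' : ContDiffOn ℝ ∞ g' U)
    (hsymm : ∀ x ∈ V, ∀ v w, g x v w = g x w v)
    (hdet : ∀ x ∈ V, (gramMatrix b (g x)).det ≠ 0)
    (hdet' : ∀ x ∈ U, (gramMatrix b (g' x)).det ≠ 0)
    (hpull : ∀ x ∈ U, ∀ v w, g' x v w = g (ψ x) (fderiv ℝ ψ x v) (fderiv ℝ ψ x w))
    (hsurj : ∀ x ∈ U, Function.Surjective (fderiv ℝ ψ x)) {x : E} (hx : x ∈ U) (v w : E) :
    fderiv ℝ ψ x (christoffelMap b (fun u => gramMatrix b (g' u)) x v w) =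
      christoffelMap b (fun u => gramMatrix b (g u)) (ψ x) (fderiv ℝ ψ x v) (fderiv ℝ ψ x w)
        + fderiv ℝ (fderiv ℝ ψ) x v w := by
  have hJ : ContDiffOn ℝ ∞ (fderiv ℝ ψ) U := hψ.fderiv_of_isOpen hU (by norm_cast)
  have hUn := hU.mem_nhds hx
  have hVn := hV.mem_nhds (hUV hx)
  have dψ := ((hψ.contDiffAt hUn).differentiableAt (by simp)).hasFDerivAt
  have dJ := ((hJ.contDiffAt hUn).differentiableAt (by simp)).hasFDerivAt
  have dg := (hg.contDiffAt hVn).differentiableAt (by simp)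
  have dg' := (hg'.contDiffAt hUn).differentiableAt (by simp)
  have s2 : ∀ v w, fderiv ℝ (fderiv ℝ ψ) x v w = fderiv ℝ (fderiv ℝ ψ) x w v := fun v w =>
    (hψ.contDiffAt hUn).isSymmSndFDerivAt (by simp; norm_cast) v w
  have hs := hsymm _ (hUV hx)
  have key : ∀ y v w, fderiv ℝ g' x y v w =
      fderiv ℝ g (ψ x) (fderiv ℝ ψ x y) (fderiv ℝ ψ x v) (fderiv ℝ ψ x w)
      + g (ψ x) (fderiv ℝ (fderiv ℝ ψ) x y v) (fderiv ℝ ψ x w)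
      + g (ψ x) (fderiv ℝ ψ x v) (fderiv ℝ (fderiv ℝ ψ) x y w) := by
    intro y v w
    have cv := fun v : E => (hasFDerivAt_const v x : HasFDerivAt (𝕜 := ℝ) (fun _ : E => v) 0 x)
    have l := (dg'.hasFDerivAt.clm_apply (cv v)).clm_apply (cv w)
    have r := ((dg.hasFDerivAt.comp x dψ).clm_apply (dJ.clm_apply (cv v))).clm_apply
      (dJ.clm_apply (cv w))
    have he : (fun u => g' u v w) =ᶠ[𝓝 x] _ :=
      Filter.eventually_of_mem hUn fun u hu => hpull u hu v w
    have e := congrArg (fun L => L y) (l.unique (r.congr_of_eventuallyEq he))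
    simp only [Function.comp_apply, add_apply, ContinuousLinearMap.flip_apply, zero_apply,
      ContinuousLinearMap.comp_apply, map_zero, zero_add] at e
    rw [e]
    ring
  refine eq_of_gramMatrix_det_ne_zero b (hdet _ (hUV hx)) fun z => ?_
  obtain ⟨z, rfl⟩ := hsurj x hx z
  rw [← hpull x hx]
  have hs' : ∀ v w, g' x v w = g' x w v := fun v w => by rw [hpull x hx, hpull x hx, hs]
  have k1 := christoffelMap_koszul b dg' hs' (hdet' x hx) v w z
  have k2 := christoffelMap_koszul b dg hs (hdet _ (hUV hx)) (fderiv ℝ ψ x v) (fderiv ℝ ψ x w)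
    (fderiv ℝ ψ x z)
  rw [key, key, key] at k1
  rw [map_add, add_apply]
  rw [s2 w v, s2 z v, s2 z w, hs (fderiv ℝ (fderiv ℝ ψ) x v z)] at k1
  linarith

/-- The coordinate expression of the Ricci tensor is its invariant definition as a trace. -/
lemma coordRicci_eq_ricciForm {G : E → Matrix ι ι ℝ} {u : E} {V : Set E} (hV : IsOpen V)
    (hu : u ∈ V) (hsymm : ∀ x ∈ V, (G x).IsSymm)
    (h : DifferentiableAt ℝ (christoffelMap b G) u) (i j : ι) :
    coordRicci b univ G i j u = ricciForm (christoffelMap b G) u (b j) (b i) := by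
  have hd : ∀ k i j l, coordDeriv b univ (christoffel b univ G k i j) l u =
      b.coord k (fderiv ℝ (christoffelMap b G) u (b l) (b i) (b j)) := by
    intro k i j l
    have h1 := (h.hasFDerivAt.clm_apply (hasFDerivAt_const (b i) u)).clm_apply
      (hasFDerivAt_const (b j) u)
    have h2 := (b.coord k).toContinuousLinearMap.hasFDerivAt.comp u h1
    have he : ((b.coord k).toContinuousLinearMap ∘ fun y => christoffelMap b G y (b i) (b j)) =
        christoffel b univ G k i j := by
      funext y
      exact coord_christoffelMap_basis b G y k i j
    rw [he] at h2
    rw [HasFDerivAt.coordDeriv_eq b h2]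
    simp
  rw [ricciForm, LinearMap.trace_eq_matrix_trace ℝ b, Matrix.trace, coordRicci,
    ← Finset.sum_add_distrib]
  refine Finset.sum_congr rfl fun k _ => ?_
  rw [Matrix.diag_apply, LinearMap.toMatrix_apply]
  change _ = b.coord k (curvatureMap (christoffelMap b G) u (b j) (b i) (b k))
  have hcomp : ∀ p i j, b.coord k (christoffelMap b G u (b p) (christoffelMap b G u (b i) (b j))) =
      ∑ l, christoffel b univ G k p l u * christoffel b univ G l i j u := by
    intro p i j
    rw [christoffelMap_basis b G u i j]
    simp only [map_sum, map_smul, smul_eq_mul, coord_christoffelMap_basis]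
    exact Finset.sum_congr rfl fun l _ => mul_comm _ _
  have hsym := fun k => christoffel_symm b hV hsymm k i j
  have hdsym := fun k l => coordDeriv_congr b (mem_univ u)
    (f := christoffel b univ G k i j) (f' := christoffel b univ G k j i)
    (by rw [nhdsWithin_univ]; exact Filter.eventually_of_mem (hV.mem_nhds hu) (hsym k)) l
  have hsym' := fun k l => christoffel_symm b hV hsymm k i l u hu
  have hdsym' := fun k l p => coordDeriv_congr b (mem_univ u)
    (f := christoffel b univ G k i l) (f' := christoffel b univ G k l i)
    (by rw [nhdsWithin_univ]
        exact Filter.eventually_of_mem (hV.mem_nhds hu) (christoffel_symm b hV hsymm k i l)) p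
  rw [curvatureMap_apply, map_sub, map_add, map_sub, hcomp, hcomp, ← hd, ← hd,
    Finset.sum_sub_distrib]
  simp only [hsym _ u hu, hsym', hdsym, hdsym']
  ring

/-- The scalar curvature is invariant under changes of coordinates. -/
theorem coordScalarCurvature_pullback {ψ : E → E} {U V : Set E} (hU : IsOpen U) (hV : IsOpen V)
    (hψ : ContDiffOn ℝ ∞ ψ U) (hUV : MapsTo ψ U V) {g g' : E → E →L[ℝ] E →L[ℝ] ℝ}
    (hg : ContDiffOn ℝ ∞ g V) (hg' : ContDiffOn ℝ ∞ g' U)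
    (hsymm : ∀ x ∈ V, ∀ v w, g x v w = g x w v)
    (hdet : ∀ x ∈ V, (gramMatrix b (g x)).det ≠ 0)
    (hdet' : ∀ x ∈ U, (gramMatrix b (g' x)).det ≠ 0)
    (hpull : ∀ x ∈ U, ∀ v w, g' x v w = g (ψ x) (fderiv ℝ ψ x v) (fderiv ℝ ψ x w))
    {u : E} (hu : u ∈ U) :
    coordScalarCurvature b univ (fun x => gramMatrix b (g' x)) u =
      coordScalarCurvature b univ (fun x => gramMatrix b (g x)) (ψ u) := by
  have hinj : ∀ x ∈ U, Function.Injective (fderiv ℝ ψ x) := fun x hx v w hvw =>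
    eq_of_gramMatrix_det_ne_zero b (hdet' x hx) fun z => by rw [hpull x hx, hpull x hx, hvw]
  have hsurj : ∀ x ∈ U, Function.Surjective (fderiv ℝ ψ x) := fun x hx =>
    LinearMap.surjective_of_injective (f := (fderiv ℝ ψ x : E →ₗ[ℝ] E)) (hinj x hx)
  have hsymm' : ∀ x ∈ U, ∀ v w, g' x v w = g' x w v := fun x hx v w => by
    rw [hpull x hx, hpull x hx, hsymm _ (hUV hx)]
  set Γ := christoffelMap b fun x => gramMatrix b (g x) with hΓdef
  set Γ' := christoffelMap b fun x => gramMatrix b (g' x) with hΓdef'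
  have hΓ : DifferentiableAt ℝ Γ (ψ u) := ((contDiffOn_christoffelMap b hV
    (contDiffOn_gramMatrix b hg) hdet).contDiffAt (hV.mem_nhds (hUV hu))).differentiableAt (by simp)
  have hΓ' : DifferentiableAt ℝ Γ' u := ((contDiffOn_christoffelMap b hU
    (contDiffOn_gramMatrix b hg') hdet').contDiffAt (hU.mem_nhds hu)).differentiableAt (by simp)
  have hcurv := fderiv_curvatureMap hU hψ hu hΓ hΓ' fun x hx v w =>
    fderiv_christoffelMap b hU hV hψ hUV hg hg' hsymm hdet hdet' hpull hsurj hx v w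
  let J : E ≃ₗ[ℝ] E := LinearEquiv.ofBijective (fderiv ℝ ψ u : E →ₗ[ℝ] E) ⟨hinj u hu, hsurj u hu⟩
  have hJ : ∀ v, J v = fderiv ℝ ψ u v := fun _ => rfl
  have hric : ∀ v w, ricciForm Γ' u v w = ricciForm Γ (ψ u) (J v) (J w) := by
    intro v w
    rw [ricciForm, ricciForm, ← LinearMap.trace_conj' _ J]
    congr 1
    ext x
    obtain ⟨x, rfl⟩ := J.surjective x
    simp only [LinearEquiv.conj_apply, LinearMap.comp_apply, LinearEquiv.coe_coe,
      J.symm_apply_apply, ContinuousLinearMap.coe_coe]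
    exact hcurv v w x
  -- In matrix form both the metric and the Ricci tensor are conjugated by the Jacobian matrix.
  let A : Matrix ι ι ℝ := LinearMap.toMatrix b b J
  have hA : ∀ i, J (b i) = ∑ k, A k i • b k := fun i => by
    conv_lhs => rw [← b.sum_repr (J (b i))]
    simp [A, LinearMap.toMatrix_apply]
  let R : Matrix ι ι ℝ := Matrix.of fun i j => ricciForm Γ (ψ u) (b j) (b i)
  let R' : Matrix ι ι ℝ := Matrix.of fun i j => ricciForm Γ' u (b j) (b i)
  have hR : R' = A.transpose * R * A := by
    ext i j
    simp only [R', R, Matrix.of_apply, hric, hA, ricciForm_sum, Matrix.mul_apply,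
      Matrix.transpose_apply, Finset.sum_mul]
    refine Finset.sum_congr rfl fun k _ => Finset.sum_congr rfl fun l _ => by ring
  have hG : gramMatrix b (g' u) = A.transpose * gramMatrix b (g (ψ u)) * A := by
    ext i j
    rw [gramMatrix_apply, hpull u hu, ← hJ, ← hJ, hA, hA]
    simp only [map_sum, map_smul, sum_apply, smul_apply, smul_eq_mul, Matrix.mul_apply,
      Matrix.transpose_apply, Finset.sum_mul, gramMatrix_apply, Finset.mul_sum]
    refine Finset.sum_congr rfl fun k _ => Finset.sum_congr rfl fun l _ => by ring
  have hsc : ∀ (M N : Matrix ι ι ℝ), ∑ i, ∑ j, M i j * N i j = (M * N.transpose).trace := by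
    intro M N
    simp [Matrix.trace, Matrix.mul_apply]
  have hAdet : IsUnit A.det := by
    have h := hdet' u hu
    rw [hG, Matrix.det_mul] at h
    exact isUnit_iff_ne_zero.2 (right_ne_zero_of_mul h)
  have hleft : coordScalarCurvature b univ (fun x => gramMatrix b (g' x)) u =
      ((gramMatrix b (g' u))⁻¹ * R'.transpose).trace := by
    rw [← hsc, coordScalarCurvature]
    refine Finset.sum_congr rfl fun i _ => Finset.sum_congr rfl fun j _ => ?_
    rw [coordRicci_eq_ricciForm b hU hu (fun x hx => ?_) hΓ' i j]
    · rfl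
    · ext i j
      exact hsymm' x hx _ _
  have hright : coordScalarCurvature b univ (fun x => gramMatrix b (g x)) (ψ u) =
      ((gramMatrix b (g (ψ u)))⁻¹ * R.transpose).trace := by
    rw [← hsc, coordScalarCurvature]
    refine Finset.sum_congr rfl fun i _ => Finset.sum_congr rfl fun j _ => ?_
    rw [coordRicci_eq_ricciForm b hV (hUV hu) (fun x hx => ?_) hΓ i j]
    · rfl
    · ext i j
      exact hsymm x hx _ _
  rw [hleft, hright, hG, hR, Matrix.mul_inv_rev, Matrix.mul_inv_rev, Matrix.transpose_mul,
    Matrix.transpose_mul, Matrix.transpose_transpose]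
  have hAt : IsUnit A.transpose.det := by rwa [Matrix.det_transpose]
  calc (A⁻¹ * ((gramMatrix b (g (ψ u)))⁻¹ * A.transpose⁻¹) *
        (A.transpose * (R.transpose * A))).trace
      = (A⁻¹ * ((gramMatrix b (g (ψ u)))⁻¹ * (A.transpose⁻¹ *
        A.transpose) * R.transpose * A)).trace := by simp only [Matrix.mul_assoc]
    _ = _ := by
      rw [Matrix.nonsing_inv_mul _ hAt, Matrix.mul_one, Matrix.trace_mul_comm, Matrix.mul_assoc,
        Matrix.mul_nonsing_inv _ hAdet, Matrix.mul_one]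

end Invariance

/-! ### Conformal change of the metric in coordinates -/

section Conformal
open Topology Filter

variable {ι E : Type*} [NormedAddCommGroup E] [NormedSpace ℝ E] (b : Module.Basis ι ℝ E)

/-- The value, the first and the second partial derivatives of `w` at `u`. -/
def jetTwo (w : E → ℝ) (u : E) : ℝ × (ι → ℝ) × (ι → ι → ℝ) :=
  (w u, fun i => coordDeriv b univ w i u,
    fun i j => coordDeriv b univ (coordDeriv b univ w i) j u)

lemma coordDeriv_sub {f f' : E → ℝ} {u : E} (hf : DifferentiableAt ℝ f u)
    (hf' : DifferentiableAt ℝ f' u) (k : ι) : coordDeriv b univ (fun x => f x - f' x) k u =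
      coordDeriv b univ f k u - coordDeriv b univ f' k u := by
  rw [(hf.hasFDerivAt.fun_sub hf'.hasFDerivAt).coordDeriv_eq b k]
  simp [coordDeriv_univ]

lemma coordDeriv_mul {f f' : E → ℝ} {u : E} (hf : DifferentiableAt ℝ f u)
    (hf' : DifferentiableAt ℝ f' u) (k : ι) : coordDeriv b univ (fun x => f x * f' x) k u =
      coordDeriv b univ f k u * f' u + f u * coordDeriv b univ f' k u := by
  rw [(hf.hasFDerivAt.fun_mul hf'.hasFDerivAt).coordDeriv_eq b k]
  simp [coordDeriv_univ]
  ring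

lemma coordDeriv_const (c : ℝ) (u : E) (k : ι) : coordDeriv b univ (fun _ => c) k u = 0 := by
  simp [coordDeriv_univ]

lemma coordDeriv_inv {f : E → ℝ} {u : E} (hf : DifferentiableAt ℝ f u) (h0 : f u ≠ 0) (k : ι) :
    coordDeriv b univ (fun x => (f x)⁻¹) k u = -coordDeriv b univ f k u / f u ^ 2 := by
  have h := (hasDerivAt_inv h0).comp_hasFDerivAt u hf.hasFDerivAt
  have := HasFDerivAt.coordDeriv_eq b h k
  rw [Function.comp_def] at this
  rw [this]
  simp [coordDeriv_univ]
  ring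

lemma coordDeriv_sum {α : Type*} (s : Finset α) {f : α → E → ℝ} {u : E}
    (hf : ∀ a ∈ s, DifferentiableAt ℝ (f a) u) (k : ι) :
    coordDeriv b univ (fun x => ∑ a ∈ s, f a x) k u = ∑ a ∈ s, coordDeriv b univ (f a) k u := by
  rw [(HasFDerivAt.fun_sum fun a ha => (hf a ha).hasFDerivAt).coordDeriv_eq b k]
  simp [coordDeriv_univ, sum_apply]

lemma continuousOn_jetTwo {U : Set E} (hU : IsOpen U) {w : E → ℝ} (hw : ContDiffOn ℝ ∞ w U) :
    ContinuousOn (jetTwo b w) U := by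
  have h1 := fun i => contDiffOn_coordDeriv b hU hw i
  have h2 := fun i j => (contDiffOn_coordDeriv b hU (h1 i) j).continuousOn
  exact hw.continuousOn.prodMk ((continuousOn_pi.2 fun i => (h1 i).continuousOn).prodMk
    (continuousOn_pi.2 fun i => continuousOn_pi.2 fun j => h2 i j))

lemma jetTwo_sum {U : Set E} (hU : IsOpen U) {α : Type*} (s : Finset α) (c : α → ℝ)
    {w : α → E → ℝ} (hw : ∀ a ∈ s, ContDiffOn ℝ ∞ (w a) U) {u : E} (hu : u ∈ U) :
    jetTwo b (fun x => ∑ a ∈ s, c a * w a x) u = ∑ a ∈ s, c a • jetTwo b (w a) u := by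
  have d0 : ∀ x ∈ U, ∀ a ∈ s, DifferentiableAt ℝ (w a) x := fun x hx a ha =>
    ((hw a ha).contDiffAt (hU.mem_nhds hx)).differentiableAt (by simp)
  have d1 : ∀ i, ∀ a ∈ s, DifferentiableAt ℝ (coordDeriv b univ (w a) i) u := fun i a ha =>
    ((contDiffOn_coordDeriv b hU (hw a ha) i).contDiffAt (hU.mem_nhds hu)).differentiableAt
      (by simp)
  have e1 : ∀ x ∈ U, ∀ i, coordDeriv b univ (fun x => ∑ a ∈ s, c a * w a x) i x =
      ∑ a ∈ s, c a * coordDeriv b univ (w a) i x := by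
    intro x hx i
    rw [coordDeriv_sum b s fun a ha => (d0 x hx a ha).const_mul _]
    refine Finset.sum_congr rfl fun a ha => ?_
    rw [coordDeriv_mul b (differentiableAt_const _) (d0 x hx a ha), coordDeriv_const]
    ring
  have e2 : ∀ i j, coordDeriv b univ (coordDeriv b univ (fun x => ∑ a ∈ s, c a * w a x) i) j u =
      ∑ a ∈ s, c a * coordDeriv b univ (coordDeriv b univ (w a) i) j u := by
    intro i j
    rw [coordDeriv_congr b (mem_univ u)
      (f' := fun x => ∑ a ∈ s, c a * coordDeriv b univ (w a) i x)
      (by rw [nhdsWithin_univ]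
          exact Filter.eventually_of_mem (hU.mem_nhds hu) fun x hx => e1 x hx i)]
    rw [coordDeriv_sum b s fun a ha => (d1 i a ha).const_mul _]
    refine Finset.sum_congr rfl fun a ha => ?_
    rw [coordDeriv_mul b (differentiableAt_const _) (d1 i a ha), coordDeriv_const]
    ring
  refine Prod.ext ?_ (Prod.ext ?_ ?_)
  · simp [jetTwo, Prod.fst_sum]
  · funext i
    simp [jetTwo, Prod.snd_sum, Prod.fst_sum, e1 u hu]
  · funext i j
    simp [jetTwo, Prod.snd_sum, e2]

variable [Fintype ι] [DecidableEq ι]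

/-- The coefficients `βᵏᵢⱼₐ` of the difference between the Christoffel symbols of `H` and those of
`w⁻² H`, which is `w⁻¹ ∑ₐ βᵏᵢⱼₐ ∂ₐ w`. -/
def conformalCoeff {X : Type*} (H : X → Matrix ι ι ℝ) (k i j a : ι) (u : X) : ℝ :=
  ∑ l, (H u)⁻¹ k l * ((if a = i then H u j l else 0) + (if a = j then H u i l else 0)
    - (if a = l then H u i j else 0))

lemma sum_conformalCoeff {X : Type*} (H : X → Matrix ι ι ℝ) (k i j : ι) (u : X) (p : ι → ℝ) :
    ∑ a, conformalCoeff H k i j a u * p a =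
      ∑ l, (H u)⁻¹ k l * (p i * H u j l + p j * H u i l - p l * H u i j) := by
  simp only [conformalCoeff, Finset.sum_mul]
  rw [Finset.sum_comm]
  refine Finset.sum_congr rfl fun l _ => ?_
  simp only [mul_assoc, ← Finset.mul_sum, sub_mul, add_mul, ite_mul, zero_mul,
    Finset.sum_sub_distrib, Finset.sum_add_distrib, Finset.sum_ite_eq', Finset.mem_univ, if_true]
  ring

lemma contDiffOn_conformalCoeff {U : Set E} {H : E → Matrix ι ι ℝ}
    (hH : ∀ i j, ContDiffOn ℝ ∞ (fun u => H u i j) U) (hdet : ∀ u ∈ U, (H u).det ≠ 0)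
    (k i j a : ι) : ContDiffOn ℝ ∞ (conformalCoeff H k i j a) U := by
  refine ContDiffOn.sum fun l _ => (contDiffOn_inv_apply hH hdet k l).mul ?_
  refine ContDiffOn.sub (ContDiffOn.add ?_ ?_) ?_ <;> split_ifs <;>
    first | exact contDiffOn_const | exact hH _ _

lemma inv_conformal {H : Matrix ι ι ℝ} (hH : H.det ≠ 0) {c : ℝ} (hc : c ≠ 0) :
    ((c ^ 2)⁻¹ • H)⁻¹ = c ^ 2 • H⁻¹ := by
  refine Matrix.inv_eq_left_inv ?_
  rw [Matrix.smul_mul, Matrix.mul_smul, smul_smul, Matrix.nonsing_inv_mul _ hH.isUnit,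
    mul_inv_cancel₀ (pow_ne_zero 2 hc), one_smul]

lemma christoffel_conformal {U : Set E} (hU : IsOpen U) {H : E → Matrix ι ι ℝ}
    (hH : ∀ i j, ContDiffOn ℝ ∞ (fun u => H u i j) U) (hdet : ∀ u ∈ U, (H u).det ≠ 0)
    {w : E → ℝ} (hw : ContDiffOn ℝ ∞ w U) (hw0 : ∀ u ∈ U, w u ≠ 0) (k i j : ι) {u : E}
    (hu : u ∈ U) :
    christoffel b univ (fun x => (w x ^ 2)⁻¹ • H x) k i j u =
      christoffel b univ H k i j u
        - (w u)⁻¹ * ∑ a, conformalCoeff H k i j a u * coordDeriv b univ w a u := by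
  have hUn := hU.mem_nhds hu
  have dw := (hw.contDiffAt hUn).differentiableAt (by simp)
  have dH := fun i j => ((hH i j).contDiffAt hUn).differentiableAt (by simp)
  have h0 := hw0 u hu
  have hd : ∀ i j l, coordDeriv b univ (fun x => ((w x ^ 2)⁻¹ • H x) i j) l u =
      (w u ^ 2)⁻¹ * coordDeriv b univ (fun x => H x i j) l u
        - 2 * (w u ^ 2)⁻¹ * (w u)⁻¹ * coordDeriv b univ w l u * H u i j := by
    intro i j l
    simp only [Matrix.smul_apply, smul_eq_mul, pow_two]
    rw [coordDeriv_mul b (f := fun x => (w x * w x)⁻¹) ((dw.mul dw).inv (mul_ne_zero h0 h0))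
      (dH i j), coordDeriv_inv b (f := fun x => w x * w x) (dw.mul dw) (mul_ne_zero h0 h0),
      coordDeriv_mul b dw dw]
    field_simp
    ring
  simp only [christoffel, hd, inv_conformal (hdet u hu) h0]
  rw [sum_conformalCoeff, Finset.mul_sum, Finset.mul_sum, Finset.mul_sum, ← Finset.sum_sub_distrib]
  refine Finset.sum_congr rfl fun l _ => ?_
  simp only [Matrix.smul_apply, smul_eq_mul]
  field_simp
  ring

/-- The Ricci tensor of `w⁻² H` multiplied by `w²`, as a quadratic form in the 2-jet of `w`. -/
def conformalRicci (H : E → Matrix ι ι ℝ) (i j : ι) (u : E) (J : ℝ × (ι → ℝ) × (ι → ι → ℝ)) : ℝ :=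
  let B := fun k i j => ∑ a, conformalCoeff H k i j a u * J.2.1 a
  let DB := fun k i j r => ∑ a, (coordDeriv b univ (conformalCoeff H k i j a) r u * J.2.1 a
    + conformalCoeff H k i j a u * J.2.2 a r)
  (∑ k, ((J.1 ^ 2 * coordDeriv b univ (christoffel b univ H k i j) k u + J.2.1 k * B k i j
        - J.1 * DB k i j k)
      - (J.1 ^ 2 * coordDeriv b univ (christoffel b univ H k i k) j u + J.2.1 j * B k i k
        - J.1 * DB k i k j)))
    + ∑ k, ∑ l, ((J.1 * christoffel b univ H k k l u - B k k l)
        * (J.1 * christoffel b univ H l i j u - B l i j)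
      - (J.1 * christoffel b univ H k j l u - B k j l)
        * (J.1 * christoffel b univ H l i k u - B l i k))

/-- The scalar curvature of `w⁻² H`, as a quadratic form in the 2-jet of `w`. -/
def conformalScalar (H : E → Matrix ι ι ℝ) (u : E) (J : ℝ × (ι → ℝ) × (ι → ι → ℝ)) : ℝ :=
  ∑ i, ∑ j, (H u)⁻¹ i j * conformalRicci b H i j u J

/-- The exponent `-2` makes the scalar curvature of the conformal metric polynomial in the 2-jet of
the conformal factor. -/
theorem coordScalarCurvature_conformal {U : Set E} (hU : IsOpen U) {H : E → Matrix ι ι ℝ}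
    (hH : ∀ i j, ContDiffOn ℝ ∞ (fun u => H u i j) U) (hdet : ∀ u ∈ U, (H u).det ≠ 0)
    {w : E → ℝ} (hw : ContDiffOn ℝ ∞ w U) (hw0 : ∀ u ∈ U, w u ≠ 0) {u : E} (hu : u ∈ U) :
    coordScalarCurvature b univ (fun x => (w x ^ 2)⁻¹ • H x) u =
      conformalScalar b H u (jetTwo b w u) := by
  have hUn := hU.mem_nhds hu
  have dw := (hw.contDiffAt hUn).differentiableAt (by simp)
  have ddw := fun a => ((contDiffOn_coordDeriv b hU hw a).contDiffAt hUn).differentiableAt (by simp)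
  have dβ := fun k i j a => ((contDiffOn_conformalCoeff hH hdet k i j a).contDiffAt
    hUn).differentiableAt (by simp)
  have dΓ := fun k i j => ((contDiffOn_christoffel b hU hH hdet k i j).contDiffAt
    hUn).differentiableAt (by simp)
  have h0 := hw0 u hu
  have hc := fun k i j => christoffel_conformal b hU hH hdet hw hw0 k i j hu
  have hdc : ∀ k i j r, coordDeriv b univ
      (christoffel b univ (fun x => (w x ^ 2)⁻¹ • H x) k i j) r u =
      coordDeriv b univ (christoffel b univ H k i j) r u
      + coordDeriv b univ w r u / w u ^ 2 *
          ∑ a, conformalCoeff H k i j a u * coordDeriv b univ w a u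
      - (w u)⁻¹ * ∑ a, (coordDeriv b univ (conformalCoeff H k i j a) r u * coordDeriv b univ w a u
        + conformalCoeff H k i j a u * coordDeriv b univ (coordDeriv b univ w a) r u) := by
    intro k i j r
    rw [coordDeriv_congr b (mem_univ u) (f' := fun u => christoffel b univ H k i j u
        - (w u)⁻¹ * ∑ a, conformalCoeff H k i j a u * coordDeriv b univ w a u)
      (by rw [nhdsWithin_univ]
          exact Filter.eventually_of_mem hUn fun x hx =>
            christoffel_conformal b hU hH hdet hw hw0 k i j hx)]
    have ds : DifferentiableAt ℝ
        (fun u => ∑ a, conformalCoeff H k i j a u * coordDeriv b univ w a u) u :=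
      DifferentiableAt.fun_sum fun a _ => (dβ k i j a).mul (ddw a)
    have di : DifferentiableAt ℝ (fun u => (w u)⁻¹) u := dw.inv h0
    rw [coordDeriv_sub b (dΓ k i j) (di.fun_mul ds), coordDeriv_mul b di ds,
      coordDeriv_inv b dw h0, coordDeriv_sum b _ fun a _ => (dβ k i j a).fun_mul (ddw a)]
    simp only [coordDeriv_mul b (dβ k i j _) (ddw _)]
    ring
  simp only [coordScalarCurvature, conformalScalar, inv_conformal (hdet u hu) h0]
  refine Finset.sum_congr rfl fun i _ => Finset.sum_congr rfl fun j _ => ?_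
  rw [Matrix.smul_apply, smul_eq_mul, mul_comm (w u ^ 2), mul_assoc]
  congr 1
  simp only [coordRicci, conformalRicci, jetTwo, hdc, hc]
  rw [mul_add, Finset.mul_sum, Finset.mul_sum]
  congr 1
  · refine Finset.sum_congr rfl fun k _ => ?_
    field_simp
  · refine Finset.sum_congr rfl fun k _ => ?_
    rw [Finset.mul_sum]
    refine Finset.sum_congr rfl fun l _ => ?_
    field_simp

lemma conformalScalar_smul (H : E → Matrix ι ι ℝ) (u : E) (c : ℝ)
    (J : ℝ × (ι → ℝ) × (ι → ι → ℝ)) :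
    conformalScalar b H u (c • J) = c ^ 2 * conformalScalar b H u J := by
  have h1 : ∀ f : ι → ℝ, ∑ a, f a * (c * J.2.1 a) = c * ∑ a, f a * J.2.1 a := fun f => by
    rw [Finset.mul_sum]
    exact Finset.sum_congr rfl fun a _ => by ring
  have h2 : ∀ (f h : ι → ℝ) (r : ι), ∑ a, (h a * (c * J.2.1 a) + f a * (c * J.2.2 a r)) =
      c * ∑ a, (h a * J.2.1 a + f a * J.2.2 a r) := fun f h r => by
    rw [Finset.mul_sum]
    exact Finset.sum_congr rfl fun a _ => by ring
  simp only [conformalScalar, Finset.mul_sum]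
  refine Finset.sum_congr rfl fun i _ => Finset.sum_congr rfl fun j _ => ?_
  rw [mul_left_comm]
  congr 1
  simp only [conformalRicci, Prod.smul_fst, Prod.smul_snd, Pi.smul_apply, smul_eq_mul, h1, h2]
  rw [mul_add, Finset.mul_sum, Finset.mul_sum]
  congr 1
  · exact Finset.sum_congr rfl fun k _ => by ring
  · refine Finset.sum_congr rfl fun k _ => ?_
    rw [Finset.mul_sum]
    exact Finset.sum_congr rfl fun l _ => by ring

lemma continuousOn_conformalScalar {U : Set E} (hU : IsOpen U) {H : E → Matrix ι ι ℝ}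
    (hH : ∀ i j, ContDiffOn ℝ ∞ (fun u => H u i j) U) (hdet : ∀ u ∈ U, (H u).det ≠ 0) :
    ContinuousOn (fun q : E × (ℝ × (ι → ℝ) × (ι → ι → ℝ)) => conformalScalar b H q.1 q.2)
      (U ×ˢ univ) := by
  have lift : ∀ {f : E → ℝ}, ContDiffOn ℝ ∞ f U → ContinuousOn
      (fun q : E × (ℝ × (ι → ℝ) × (ι → ι → ℝ)) => f q.1) (U ×ˢ univ) := fun hf =>
    hf.continuousOn.comp continuousOn_fst fun q hq => hq.1
  have cinv := fun i j => lift (contDiffOn_inv_apply hH hdet i j)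
  have cβ := fun k i j a => lift (contDiffOn_conformalCoeff hH hdet k i j a)
  have cdβ := fun k i j a r =>
    lift (contDiffOn_coordDeriv b hU (contDiffOn_conformalCoeff hH hdet k i j a) r)
  have cΓ := fun k i j => lift (contDiffOn_christoffel b hU hH hdet k i j)
  have cdΓ := fun k i j r =>
    lift (contDiffOn_coordDeriv b hU (contDiffOn_christoffel b hU hH hdet k i j) r)
  have c0 : ContinuousOn (fun q : E × (ℝ × (ι → ℝ) × (ι → ι → ℝ)) => q.2.1) (U ×ˢ univ) :=
    Continuous.continuousOn (by fun_prop)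
  have c1 : ∀ a, ContinuousOn (fun q : E × (ℝ × (ι → ℝ) × (ι → ι → ℝ)) => q.2.2.1 a)
    (U ×ˢ univ) := fun a => Continuous.continuousOn (by fun_prop)
  have c2 : ∀ a r, ContinuousOn (fun q : E × (ℝ × (ι → ℝ) × (ι → ι → ℝ)) => q.2.2.2 a r)
    (U ×ˢ univ) := fun a r => Continuous.continuousOn (by fun_prop)
  have cB : ∀ k i j, ContinuousOn (fun q : E × (ℝ × (ι → ℝ) × (ι → ι → ℝ)) =>
      ∑ a, conformalCoeff H k i j a q.1 * q.2.2.1 a) (U ×ˢ univ) := fun k i j =>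
    continuousOn_finsetSum _ fun a _ => (cβ k i j a).mul (c1 a)
  have cDB : ∀ k i j r, ContinuousOn (fun q : E × (ℝ × (ι → ℝ) × (ι → ι → ℝ)) =>
      ∑ a, (coordDeriv b univ (conformalCoeff H k i j a) r q.1 * q.2.2.1 a
        + conformalCoeff H k i j a q.1 * q.2.2.2 a r)) (U ×ˢ univ) := fun k i j r =>
    continuousOn_finsetSum _ fun a _ =>
      ((cdβ k i j a r).mul (c1 a)).add ((cβ k i j a).mul (c2 a r))
  have cD : ∀ k i j r, ContinuousOn (fun q : E × (ℝ × (ι → ℝ) × (ι → ι → ℝ)) =>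
      q.2.1 ^ 2 * coordDeriv b univ (christoffel b univ H k i j) r q.1
        + q.2.2.1 r * (∑ a, conformalCoeff H k i j a q.1 * q.2.2.1 a)
        - q.2.1 * ∑ a, (coordDeriv b univ (conformalCoeff H k i j a) r q.1 * q.2.2.1 a
        + conformalCoeff H k i j a q.1 * q.2.2.2 a r)) (U ×ˢ univ) := fun k i j r =>
    (((c0.pow 2).mul (cdΓ k i j r)).add ((c1 r).mul (cB k i j))).sub (c0.mul (cDB k i j r))
  have cC : ∀ k i j, ContinuousOn (fun q : E × (ℝ × (ι → ℝ) × (ι → ι → ℝ)) =>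
      q.2.1 * christoffel b univ H k i j q.1 - ∑ a, conformalCoeff H k i j a q.1 * q.2.2.1 a)
      (U ×ˢ univ) := fun k i j => (c0.mul (cΓ k i j)).sub (cB k i j)
  refine continuousOn_finsetSum _ fun i _ => continuousOn_finsetSum _ fun j _ =>
    (cinv i j).mul (ContinuousOn.add (continuousOn_finsetSum _ fun k _ => ?_)
      (continuousOn_finsetSum _ fun k _ => continuousOn_finsetSum _ fun l _ => ?_))
  · exact (cD k i j k).sub (cD k i k j)
  · exact ((cC k k l).mul (cC l i j)).sub ((cC k j l).mul (cC l i k))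

/-- On a compact set, the scalar curvature of `w⁻² H` is bounded by the square of the norm of the
2-jet of `w`. -/
lemma exists_abs_conformalScalar_le {U : Set E} (hU : IsOpen U) {H : E → Matrix ι ι ℝ}
    (hH : ∀ i j, ContDiffOn ℝ ∞ (fun u => H u i j) U) (hdet : ∀ u ∈ U, (H u).det ≠ 0)
    {K : Set E} (hK : IsCompact K) (hKU : K ⊆ U) :
    ∃ C, 0 < C ∧ ∀ u ∈ K, ∀ J, |conformalScalar b H u J| ≤ C * ‖J‖ ^ 2 := by
  have hc := (continuousOn_conformalScalar b hU hH hdet).mono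
    (prod_mono hKU (subset_univ (Metric.sphere 0 1)))
  obtain ⟨C, hC⟩ := (hK.prod (isCompact_sphere 0 1)).exists_bound_of_continuousOn hc
  refine ⟨max C 1, by positivity, fun u hu J => ?_⟩
  rcases eq_or_ne J 0 with rfl | hJ
  · have := conformalScalar_smul b H u 0 0
    rw [zero_smul, zero_pow two_ne_zero, zero_mul] at this
    simp [this]
  · have hn : ‖J‖ ≠ 0 := norm_ne_zero_iff.2 hJ
    have h1 := hC (u, ‖J‖⁻¹ • J) ⟨hu, by simp [norm_smul, hn]⟩
    have h2 : conformalScalar b H u J = ‖J‖ ^ 2 * conformalScalar b H u (‖J‖⁻¹ • J) := by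
      rw [← conformalScalar_smul, smul_smul, mul_inv_cancel₀ hn, one_smul]
    rw [h2, abs_mul, abs_of_nonneg (sq_nonneg _), mul_comm]
    gcongr
    exact h1.trans (le_max_left _ _)

end Conformal

/-! ### Scalar curvature in an arbitrary chart -/

section ChartChange
open Topology Filter

variable {E H M : Type*} [NormedAddCommGroup E] [NormedSpace ℝ E] [TopologicalSpace H]
  {I : ModelWithCorners ℝ E H} [TopologicalSpace M] [ChartedSpace H M] [IsManifold I ∞ M]

lemma SmoothMetric.chartCoeff_conformal [FiniteDimensional ℝ E] (g : SmoothMetric I M) (v : M → ℝ)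
    (hv : ContMDiff I 𝓘(ℝ) ∞ v) (hv0 : ∀ x, 0 < v x) {ι : Type*} (b : Module.Basis ι ℝ E) (z : M) :
    (g.conformal v hv hv0).chartCoeff b z =
      fun u => (v ((extChartAt I z).symm u) ^ 2)⁻¹ • g.chartCoeff b z u := by
  funext u
  ext i j
  rfl

variable {ι : Type*} [Fintype ι]

/-- The metric in the chart at `z`, as a field of bilinear forms on the model space. -/
def SmoothMetric.chartForm [FiniteDimensional ℝ E] (g : SmoothMetric I M) (b : Module.Basis ι ℝ E)
    (z : M) (u : E) : E →L[ℝ] E →L[ℝ] ℝ :=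
  ∑ i, ∑ j, g.chartCoeff b z u i j •
    (b.coord i).toContinuousLinearMap.smulRight (b.coord j).toContinuousLinearMap

lemma SmoothMetric.chartForm_extChartAt [FiniteDimensional ℝ E] (g : SmoothMetric I M)
    (b : Module.Basis ι ℝ E) (z x : M) (hx : x ∈ (chartAt H z).source) (v w : E) :
    g.chartForm b z (extChartAt I z x) v w =
      g.inner x (frameMap I z x v) (frameMap I z x w) := by
  have hv : frameMap I z x v = ∑ i, b.repr v i • frameMap I z x (b i) := by
    conv_lhs => rw [← b.sum_repr v, map_sum]
    simp only [map_smul]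
  have hw : frameMap I z x w = ∑ i, b.repr w i • frameMap I z x (b i) := by
    conv_lhs => rw [← b.sum_repr w, map_sum]
    simp only [map_smul]
  rw [hv, hw]
  simp only [chartForm, sum_apply, smul_apply, ContinuousLinearMap.smulRight_apply,
    LinearMap.coe_toContinuousLinearMap', Module.Basis.coord_apply, smul_eq_mul, map_sum, map_smul,
    Finset.mul_sum, chartCoeff_apply g b z x hx]
  rw [Finset.sum_comm]
  refine Finset.sum_congr rfl fun i _ => Finset.sum_congr rfl fun j _ => by ring

lemma SmoothMetric.contDiffOn_chartForm [FiniteDimensional ℝ E] [I.Boundaryless]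
    (g : SmoothMetric I M) (b : Module.Basis ι ℝ E) (z : M) :
    ContDiffOn ℝ ∞ (g.chartForm b z) (extChartAt I z).target :=
  ContDiffOn.sum fun i _ => ContDiffOn.sum fun j _ =>
    (g.contDiffOn_chartCoeff b z i j).smul contDiffOn_const

variable [DecidableEq ι]

lemma SmoothMetric.gramMatrix_chartForm [FiniteDimensional ℝ E] (g : SmoothMetric I M)
    (b : Module.Basis ι ℝ E) (z : M) (u : E) :
    gramMatrix b (g.chartForm b z u) = g.chartCoeff b z u := by
  ext i j
  simp [gramMatrix_apply, chartForm, sum_apply, Finsupp.single_apply]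

lemma SmoothMetric.chartCoeff_det_ne_zero (g : SmoothMetric I M) (b : Module.Basis ι ℝ E) (z : M)
    {u : E} (hu : u ∈ (extChartAt I z).target) : (g.chartCoeff b z u).det ≠ 0 := by
  intro h
  obtain ⟨x, hx0, hx⟩ := Matrix.exists_mulVec_eq_zero_iff.2 h
  have hs : (extChartAt I z).symm u ∈ (chartAt H z).source := by
    simpa using (extChartAt I z).map_target hu
  set p := (extChartAt I z).symm u with hp
  have hup : u = extChartAt I z p := ((extChartAt I z).right_inv hu).symm
  set v : E := ∑ i, x i • b i with hv
  have hv0 : v ≠ 0 := fun h0 => hx0 <| by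
    have := Fintype.linearIndependent_iff.1 b.linearIndependent x h0
    exact funext this
  have hpos := g.pos p (frameMap I z p v) fun h0 => hv0 <|
    frameMap_injective hs (h0.trans (map_zero _).symm)
  refine hpos.ne' ?_
  rw [hv]
  simp only [map_sum, map_smul, sum_apply, smul_apply, smul_eq_mul]
  have hx' : ∀ i, ∑ j, x j * g.inner p (frameMap I z p (b j)) (frameMap I z p (b i)) = 0 := by
    intro i
    refine Eq.trans (Finset.sum_congr rfl fun j _ => ?_) (congrFun hx i)
    rw [mul_comm, g.symm, ← chartCoeff_apply g b z p hs, hup]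
  exact (Finset.sum_congr rfl fun i _ => by rw [hx', mul_zero]).trans Finset.sum_const_zero

lemma frameMap_eq_tangentCoordChange [IsManifold I 1 M] {z x : M}
    (hx : x ∈ (chartAt H z).source) (v : E) : frameMap I z x v = tangentCoordChange I z x x v :=
  congrArg (fun L : E →L[ℝ] TangentSpace I x => L v)
    (TangentBundle.symmL_trivializationAt_eq_core (I := I) hx)

/-- The scalar curvature at `x` can be computed in any chart around `x`. -/
theorem SmoothMetric.scalarCurvature_eq_chart [FiniteDimensional ℝ E] [I.Boundaryless]
    (g : SmoothMetric I M) (b : Module.Basis ι ℝ E) (z x : M) (hx : x ∈ (chartAt H z).source) :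
    g.scalarCurvature b x = coordScalarCurvature b univ (g.chartCoeff b z) (extChartAt I z x) := by
  have : IsManifold I 1 M := .of_le (n := ∞) (by exact_mod_cast le_top)
  have hr : range I = univ := I.range_eq_univ
  set U := (extChartAt I x).target ∩ (extChartAt I x).symm ⁻¹' (extChartAt I z).source with hUdef
  have hU : IsOpen U := (continuousOn_extChartAt_symm x).isOpen_inter_preimage
    (isOpen_extChartAt_target x) (isOpen_extChartAt_source z)
  set ψ := extChartAt I z ∘ (extChartAt I x).symm with hψdef
  have hψ : ContDiffOn ℝ ∞ ψ U := by
    rw [← contMDiffOn_iff_contDiffOn]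
    exact (contMDiffOn_extChartAt (n := ∞) (x := z)).comp
      ((contMDiffOn_extChartAt_symm (n := ∞) x).mono inter_subset_left)
      fun u hu => by simpa using hu.2
  have hUV : MapsTo ψ U (extChartAt I z).target := fun u hu => (extChartAt I z).map_source hu.2
  have hu : extChartAt I x x ∈ U :=
    ⟨mem_extChartAt_target x, by simpa using hx⟩
  have key := coordScalarCurvature_pullback b hU (isOpen_extChartAt_target z) hψ hUV
    (g.contDiffOn_chartForm b z) ((g.contDiffOn_chartForm b x).mono inter_subset_left) ?_ ?_ ?_ ?_ hu
  · simp only [SmoothMetric.gramMatrix_chartForm] at key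
    rw [scalarCurvature, hr]
    refine key.trans ?_
    simp [hψdef]
  · intro u hu v w
    have hs : (extChartAt I z).symm u ∈ (chartAt H z).source := by
      simpa using (extChartAt I z).map_target hu
    rw [← (extChartAt I z).right_inv hu, chartForm_extChartAt _ _ _ _ hs,
      chartForm_extChartAt _ _ _ _ hs, g.symm]
  · intro u hu
    rw [gramMatrix_chartForm]
    exact g.chartCoeff_det_ne_zero b z hu
  · intro u hu
    rw [gramMatrix_chartForm]
    exact g.chartCoeff_det_ne_zero b x hu.1
  · intro u hu v w
    set p := (extChartAt I x).symm u with hp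
    have hup : u = extChartAt I x p := ((extChartAt I x).right_inv hu.1).symm
    have hpx : p ∈ (chartAt H x).source := by
      rw [← extChartAt_source I]
      exact (extChartAt I x).map_target hu.1
    have hpz : p ∈ (chartAt H z).source := by
      rw [← extChartAt_source I]
      exact hu.2
    have hψu : ψ u = extChartAt I z p := rfl
    have hframe : ∀ v, frameMap I x p v = frameMap I z p (fderiv ℝ ψ u v) := by
      intro v
      have h1 : fderiv ℝ ψ u = tangentCoordChange I x z p := by
        rw [tangentCoordChange_def, ← hup, hr, fderivWithin_univ]
      rw [frameMap_eq_tangentCoordChange hpx, frameMap_eq_tangentCoordChange hpz, h1]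
      exact (tangentCoordChange_comp (I := I) (w := x) (x := z) (y := p) (z := p)
        ⟨⟨by simpa using hpx, by simpa using hpz⟩, by simp⟩).symm
    rw [hψu]
    conv_lhs => rw [hup]
    rw [chartForm_extChartAt _ _ _ _ hpx, chartForm_extChartAt _ _ _ _ hpz, hframe, hframe]

end ChartChange

/-! ### Metrics with almost nonnegative scalar curvature -/

section AlmostNonneg
open Topology Filter

lemma jetTwo_congr {ι E : Type*} [NormedAddCommGroup E] [NormedSpace ℝ E]
    (b : Module.Basis ι ℝ E) {w w' : E → ℝ} {u : E} (h : w =ᶠ[𝓝 u] w') :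
    jetTwo b w u = jetTwo b w' u := by
  rw [← nhdsWithin_univ] at h
  have h1 := fun i => coordDeriv_congr b (mem_univ u) h i
  have h2 := fun i j => coordDeriv_congr b (mem_univ u) (coordDeriv_eventuallyEq b h i) j
  simp only [jetTwo, h.self_of_nhdsWithin (mem_univ u), h1, h2]

/-- Positive weights that make countably many finite sums as small as prescribed. -/
lemma exists_weights {α : Type*} (N : α → Finset α) (hN : ∀ i j, j ∈ N i → i ∈ N j)
    (A : α → α → ℝ) (hA : ∀ i j, 0 ≤ A i j) (r : α → ℝ) (hr : ∀ i, 0 < r i) :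
    ∃ c : α → ℝ, (∀ j, 0 < c j) ∧ ∀ i, ∑ j ∈ N i, c j * A i j ≤ r i := by
  have h : ∀ j, ∃ c : ℝ, 0 < c ∧ ∀ i ∈ N j, c ≤ r i / (((N i).card + 1) * (A i j + 1)) := by
    intro j
    have h1 : ∀ᶠ c in 𝓝[>] (0 : ℝ), ∀ i ∈ N j, c ≤ r i / (((N i).card + 1) * (A i j + 1)) := by
      rw [Filter.eventually_all_finset]
      intro i _
      have : 0 < r i / (((N i).card + 1) * (A i j + 1)) := by
        have := hA i j
        have := hr i
        positivity
      exact mem_nhdsWithin_of_mem_nhds (Iic_mem_nhds this)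
    exact ((eventually_mem_nhdsWithin (s := Ioi (0 : ℝ))).and h1).exists
  choose c hc0 hc using h
  refine ⟨c, hc0, fun i => ?_⟩
  have hle : ∀ j ∈ N i, c j * A i j ≤ r i / ((N i).card + 1) := by
    intro j hj
    have h1 := hc j i (hN i j hj)
    have h2 := hA i j
    calc c j * A i j ≤ c j * (A i j + 1) := by
          have := (hc0 j).le
          gcongr
          linarith
      _ ≤ r i / (((N i).card + 1) * (A i j + 1)) * (A i j + 1) := by gcongr
      _ = r i / ((N i).card + 1) := by field_simp
  refine (Finset.sum_le_card_nsmul _ _ _ hle).trans ?_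
  have hr0 := (hr i).le
  rw [nsmul_eq_mul, mul_div_assoc', div_le_iff₀ (by positivity)]
  nlinarith

variable {E H M : Type*} [NormedAddCommGroup E] [InnerProductSpace ℝ E] [FiniteDimensional ℝ E]
  [TopologicalSpace H] {I : ModelWithCorners ℝ E H} [I.Boundaryless]
  [TopologicalSpace M] [ChartedSpace H M] [IsManifold I ∞ M] [T2Space M] [SigmaCompactSpace M]
  {ι : Type*} [Fintype ι] [DecidableEq ι]

/-- Every manifold, compact or not, carries a metric whose scalar curvature is bounded below by an
arbitrarily small negative constant: multiply any metric by `v⁻²`, where `v` is a locally finite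
sum of bump functions with weights so small that the 2-jet of `v` is small in the charts. -/
theorem exists_metric_neg_le_scalarCurvature (b : Module.Basis ι ℝ E) {δ : ℝ} (hδ : 0 < δ) :
    ∃ g : SmoothMetric I M, ∀ x, -δ ≤ g.scalarCurvature b x := by
  obtain ⟨g₀⟩ := nonempty_smoothMetric (I := I) (M := M)
  obtain ⟨α, fs, -⟩ := SmoothBumpCovering.exists_isSubordinate I (M := M) (s := univ) isClosed_univ
    (U := fun _ => univ) fun _ _ => univ_mem
  set K : α → Set M := fun i => tsupport (fs i) with hKdef
  have hK : ∀ i, IsCompact (K i) := fun i => (fs i).hasCompactSupport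
  have hKs : ∀ i, K i ⊆ (chartAt H (fs.c i)).source := fun i =>
    (fs i).tsupport_subset_chartAt_source
  have hlf : LocallyFinite K := fs.locallyFinite.closure
  -- The bump functions whose support meets `K i`; the others vanish near `K i`.
  let N : α → Finset α := fun i => (hlf.finite_nonempty_inter_compact (hK i)).toFinset
  have hN : ∀ i j, j ∈ N i ↔ (K j ∩ K i).Nonempty := fun i j => by simp [N]
  let e := fun i => extChartAt I (fs.c i)
  have hes : ∀ i, K i ⊆ (e i).source := fun i => by
    simpa only [e, extChartAt_source] using hKs i
  have hK' : ∀ i, IsCompact (e i '' K i) := fun i =>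
    (hK i).image_of_continuousOn ((continuousOn_extChartAt (fs.c i)).mono (hes i))
  have hK't : ∀ i, e i '' K i ⊆ (e i).target := fun i => by
    rintro _ ⟨x, hx, rfl⟩
    exact (e i).map_source (hes i hx)
  have ht : ∀ i, IsOpen (e i).target := fun i => isOpen_extChartAt_target (fs.c i)
  have hHs := fun i => g₀.contDiffOn_chartCoeff b (fs.c i)
  have hHd := fun i u hu => g₀.chartCoeff_det_ne_zero b (fs.c i) (u := u) hu
  choose C hC0 hC using fun i => exists_abs_conformalScalar_le b (ht i) (hHs i) (hHd i) (hK' i)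
    (hK't i)
  have hpull : ∀ (f : M → ℝ), ContMDiff I 𝓘(ℝ) ∞ f → ∀ i,
      ContDiffOn ℝ ∞ (fun u => f ((e i).symm u)) (e i).target := fun f hf i => by
    rw [← contMDiffOn_iff_contDiffOn]
    exact hf.comp_contMDiffOn (contMDiffOn_extChartAt_symm (n := ∞) (fs.c i))
  have hw : ∀ i j, ContDiffOn ℝ ∞ (fun u => fs j ((e i).symm u)) (e i).target := fun i j =>
    hpull _ (fs j).contMDiff i
  -- `A i j` bounds on `K i` the 2-jet of the `j`-th bump function in the `i`-th chart.
  choose A hA using fun i j => (hK' i).exists_bound_of_continuousOn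
    ((continuousOn_jetTwo b (ht i) (hw i j)).mono (hK't i))
  -- By `hC`, a function with 2-jet of norm at most `√(δ / C i)` gives curvature at least `-δ`.
  obtain ⟨c, hc0, hc⟩ := exists_weights N
    (fun i j h => by rw [hN] at h ⊢; rwa [inter_comm]) (fun i j => max (A i j) 0)
    (fun i j => le_max_right _ _) (fun i => √(δ / C i))
    fun i => Real.sqrt_pos.2 (div_pos hδ (hC0 i))
  set v : M → ℝ := fun x => ∑ᶠ j, c j * fs j x with hvdef
  have hlf' : LocallyFinite fun j => Function.support fun x => c j * fs j x :=
    fs.locallyFinite.subset fun j x hx => right_ne_zero_of_mul hx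
  have hv : ContMDiff I 𝓘(ℝ) ∞ v :=
    contMDiff_finsum (fun j => contMDiff_const.mul (fs j).contMDiff) hlf'
  have hv0 : ∀ x, 0 < v x := by
    intro x
    refine finsum_pos (fun j => mul_nonneg (hc0 j).le (fs j).nonneg) ?_ (hlf'.point_finite x)
    exact ⟨fs.ind x (mem_univ x), by rw [fs.apply_ind, mul_one]; exact hc0 _⟩
  refine ⟨g₀.conformal v hv hv0, fun x => ?_⟩
  -- Work in the chart of a bump function whose support contains `x`.
  set i := fs.ind x (mem_univ x)
  have hxi : x ∈ K i := subset_closure (fs.mem_support_ind x (mem_univ x))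
  have hu : e i x ∈ e i '' K i := mem_image_of_mem _ hxi
  have hut : e i x ∈ (e i).target := hK't i hu
  have hux : (e i).symm (e i x) = x := (e i).left_inv (hes i hxi)
  have hnear : ∀ᶠ y in 𝓝 x, v y = ∑ j ∈ N i, c j * fs j y := by
    filter_upwards [hlf.eventually_subset (fun j => isClosed_tsupport _) x] with y hy
    refine finsum_eq_sum_of_support_subset _ fun j hj => ?_
    have hyj : y ∈ K j := subset_closure (right_ne_zero_of_mul hj)
    exact (hN i j).2 ⟨x, hy hyj, hxi⟩
  have hjet : jetTwo b (fun u => v ((e i).symm u)) (e i x) =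
      ∑ j ∈ N i, c j • jetTwo b (fun u => fs j ((e i).symm u)) (e i x) := by
    rw [← jetTwo_sum b (ht i) (N i) c (fun j _ => hw i j) hut]
    refine jetTwo_congr b ?_
    have hcont : Tendsto (e i).symm (𝓝 (e i x)) (𝓝 x) := by
      have h := (continuousOn_extChartAt_symm (I := I) (fs.c i)).continuousAt ((ht i).mem_nhds hut)
      rw [ContinuousAt] at h
      rwa [show (extChartAt I (fs.c i)).symm (e i x) = x from hux] at h
    exact hcont.eventually hnear
  have hnorm : ‖jetTwo b (fun u => v ((e i).symm u)) (e i x)‖ ≤ √(δ / C i) := by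
    rw [hjet]
    refine (norm_sum_le _ _).trans (le_trans (Finset.sum_le_sum fun j _ => ?_) (hc i))
    rw [norm_smul, Real.norm_of_nonneg (hc0 j).le]
    have := (hc0 j).le
    gcongr
    exact (hA i j _ hu).trans (le_max_left _ _)
  rw [SmoothMetric.scalarCurvature_eq_chart _ b (fs.c i) x (hKs i hxi),
    SmoothMetric.chartCoeff_conformal,
    coordScalarCurvature_conformal b (ht i) (hHs i) (hHd i) (hpull v hv i)
      (fun u _ => (hv0 _).ne') hut]
  refine neg_le_of_abs_le ((hC i _ hu _).trans ?_)
  calc C i * ‖jetTwo b (fun u => v ((e i).symm u)) (e i x)‖ ^ 2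
      ≤ C i * √(δ / C i) ^ 2 := by
        have := (hC0 i).le
        gcongr
    _ = δ := by
        rw [Real.sq_sqrt (div_pos hδ (hC0 i)).le, mul_div_cancel₀ _ (hC0 i).ne']

end AlmostNonneg

/-! ### Scalar curvature of warped products in coordinates -/

section Warped
open Topology Filter

lemma coordDeriv_eq_univ {ι E : Type*} [NormedAddCommGroup E] [NormedSpace ℝ E]
    (b : Module.Basis ι ℝ E) {S : Set E} {u : E} (hS : UniqueDiffWithinAt ℝ S u) {f : E → ℝ}
    (hf : DifferentiableAt ℝ f u) (k : ι) : coordDeriv b S f k u = coordDeriv b univ f k u := by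
  rw [coordDeriv, hf.fderivWithin hS, coordDeriv_univ]

/-- One-sided derivatives do not matter for a metric that extends smoothly across the boundary. -/
lemma coordScalarCurvature_eq_univ {ι E : Type*} [NormedAddCommGroup E] [NormedSpace ℝ E]
    [Fintype ι] [DecidableEq ι] (b : Module.Basis ι ℝ E) {S W : Set E} (hS : UniqueDiffOn ℝ S)
    (hW : IsOpen W) {G : E → Matrix ι ι ℝ} (hG : ∀ i j, ContDiffOn ℝ ∞ (fun u => G u i j) W)
    (hdet : ∀ u ∈ W, (G u).det ≠ 0) {u : E} (huS : u ∈ S) (huW : u ∈ W) :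
    coordScalarCurvature b S G u = coordScalarCurvature b univ G u := by
  have hc : ∀ x ∈ S, x ∈ W → ∀ k i j, christoffel b S G k i j x = christoffel b univ G k i j x := by
    intro x hxS hxW k i j
    have hd := fun i j l => coordDeriv_eq_univ b (hS x hxS)
      (((hG i j).contDiffAt (hW.mem_nhds hxW)).differentiableAt (by simp)) l
    simp only [christoffel, hd]
  have hdc : ∀ k i j l, coordDeriv b S (christoffel b S G k i j) l u =
      coordDeriv b univ (christoffel b univ G k i j) l u := by
    intro k i j l
    rw [coordDeriv_congr b huS (f' := christoffel b univ G k i j)]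
    · exact coordDeriv_eq_univ b (hS u huS) (((contDiffOn_christoffel b hW hG hdet k i j).contDiffAt
        (hW.mem_nhds huW)).differentiableAt (by simp)) l
    · filter_upwards [self_mem_nhdsWithin, mem_nhdsWithin_of_mem_nhds (hW.mem_nhds huW)]
        with x hxS hxW using hc x hxS hxW k i j
  simp only [coordScalarCurvature, coordRicci, hdc, hc u huS huW]

section Inverse

variable {ι E F : Type*}

/-- The coefficients of the warped product metric `κ dτ² + f(τ) H` on a product. -/
def warpedCoeff (κ : ℝ) (f : F → ℝ) (H : E → Matrix ι ι ℝ) (q : E × F) :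
    Matrix (ι ⊕ Fin 1) (ι ⊕ Fin 1) ℝ :=
  Matrix.fromBlocks (f q.2 • H q.1) 0 0 (κ • 1)

lemma warpedCoeff_mul_inv [Fintype ι] [DecidableEq ι] {κ : ℝ} {f : F → ℝ}
    {H : E → Matrix ι ι ℝ} {q : E × F} (hκ : κ ≠ 0)
    (hf : f q.2 ≠ 0) (hH : (H q.1).det ≠ 0) :
    warpedCoeff κ f H q *
      Matrix.fromBlocks ((f q.2)⁻¹ • (H q.1)⁻¹) 0 0 (κ⁻¹ • (1 : Matrix (Fin 1) (Fin 1) ℝ)) = 1 := by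
  rw [warpedCoeff, Matrix.fromBlocks_multiply]
  simp only [Matrix.smul_mul, Matrix.mul_smul, smul_smul, Matrix.mul_nonsing_inv _ hH.isUnit,
    one_smul, Matrix.mul_zero, Matrix.zero_mul, add_zero,
    zero_add, Matrix.mul_one, Matrix.fromBlocks_one, inv_mul_cancel₀ hf, inv_mul_cancel₀ hκ,
    smul_zero]

lemma warpedCoeff_inv [Fintype ι] [DecidableEq ι] {κ : ℝ} {f : F → ℝ}
    {H : E → Matrix ι ι ℝ} {q : E × F} (hκ : κ ≠ 0)
    (hf : f q.2 ≠ 0) (hH : (H q.1).det ≠ 0) : (warpedCoeff κ f H q)⁻¹ =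
      Matrix.fromBlocks ((f q.2)⁻¹ • (H q.1)⁻¹) 0 0 (κ⁻¹ • 1) :=
  Matrix.inv_eq_right_inv (warpedCoeff_mul_inv hκ hf hH)

lemma warpedCoeff_det_ne_zero [Fintype ι] [DecidableEq ι] {κ : ℝ} {f : F → ℝ}
    {H : E → Matrix ι ι ℝ} {q : E × F} (hκ : κ ≠ 0)
    (hf : f q.2 ≠ 0) (hH : (H q.1).det ≠ 0) : (warpedCoeff κ f H q).det ≠ 0 := by
  intro h
  have := congrArg Matrix.det (warpedCoeff_mul_inv hκ hf hH)
  rw [Matrix.det_mul, h, zero_mul, Matrix.det_one] at this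
  exact zero_ne_one this

end Inverse

variable {ι E F : Type*} [NormedAddCommGroup E] [NormedSpace ℝ E] [NormedAddCommGroup F]
  [NormedSpace ℝ F] (b : Module.Basis ι ℝ E) (c : Module.Basis (Fin 1) ℝ F)

lemma coordDeriv_prod_inl {A : F → ℝ} {h : E → ℝ} {u : E} {τ : F} (hA : DifferentiableAt ℝ A τ)
    (hh : DifferentiableAt ℝ h u) (k : ι) :
    coordDeriv (b.prod c) univ (fun q : E × F => A q.2 * h q.1) (Sum.inl k) (u, τ) =
      A τ * coordDeriv b univ h k u := by
  have h1 : HasFDerivAt (fun q : E × F => A q.2) _ (u, τ) :=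
    HasFDerivAt.comp (u, τ) (f := Prod.snd) (g := A) hA.hasFDerivAt hasFDerivAt_snd
  have h2 : HasFDerivAt (fun q : E × F => h q.1) _ (u, τ) :=
    HasFDerivAt.comp (u, τ) (f := Prod.fst) (g := h) hh.hasFDerivAt hasFDerivAt_fst
  rw [(h1.fun_mul h2).coordDeriv_eq, coordDeriv_univ]
  simp

lemma coordDeriv_prod_inr {A : F → ℝ} {h : E → ℝ} {u : E} {τ : F} (hA : DifferentiableAt ℝ A τ)
    (hh : DifferentiableAt ℝ h u) (l : Fin 1) :
    coordDeriv (b.prod c) univ (fun q : E × F => A q.2 * h q.1) (Sum.inr l) (u, τ) =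
      coordDeriv c univ A l τ * h u := by
  have h1 : HasFDerivAt (fun q : E × F => A q.2) _ (u, τ) :=
    HasFDerivAt.comp (u, τ) (f := Prod.snd) (g := A) hA.hasFDerivAt hasFDerivAt_snd
  have h2 : HasFDerivAt (fun q : E × F => h q.1) _ (u, τ) :=
    HasFDerivAt.comp (u, τ) (f := Prod.fst) (g := h) hh.hasFDerivAt hasFDerivAt_fst
  rw [(h1.fun_mul h2).coordDeriv_eq, coordDeriv_univ]
  simp [mul_comm]

lemma contDiffOn_warpedCoeff {κ : ℝ} {f : F → ℝ} {H : E → Matrix ι ι ℝ} {U : Set E} {T : Set F}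
    (hH : ∀ i j, ContDiffOn ℝ ∞ (fun u => H u i j) U) (hf : ContDiffOn ℝ ∞ f T)
    (i j : ι ⊕ Fin 1) : ContDiffOn ℝ ∞ (fun q => warpedCoeff κ f H q i j) (U ×ˢ T) := by
  rcases i with i | i <;> rcases j with j | j
  · exact (hf.comp contDiffOn_snd fun q hq => hq.2).mul
      ((hH i j).comp contDiffOn_fst fun q hq => hq.1)
  all_goals exact contDiffOn_const

section Christoffel

variable {κ : ℝ} {f L : F → ℝ} {H : E → Matrix ι ι ℝ} {U : Set E} {T : Set F}

lemma coordDeriv_warpedCoeff_inl {u : E} {τ : F}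
    (hH : ∀ i j, DifferentiableAt ℝ (fun u => H u i j) u) (hf : DifferentiableAt ℝ f τ)
    (i j k : ι) :
    coordDeriv (b.prod c) univ (fun q => warpedCoeff κ f H q (Sum.inl i) (Sum.inl j)) (Sum.inl k)
      (u, τ) = f τ * coordDeriv b univ (fun u => H u i j) k u :=
  coordDeriv_prod_inl b c hf (hH i j) k

lemma coordDeriv_warpedCoeff_inr {u : E} {τ : F}
    (hH : ∀ i j, DifferentiableAt ℝ (fun u => H u i j) u) (hf : DifferentiableAt ℝ f τ)
    (i j : ι) (l : Fin 1) :
    coordDeriv (b.prod c) univ (fun q => warpedCoeff κ f H q (Sum.inl i) (Sum.inl j)) (Sum.inr l)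
      (u, τ) = coordDeriv c univ f l τ * H u i j :=
  coordDeriv_prod_inr b c hf (hH i j) l

lemma coordDeriv_warpedCoeff_lr (u : E) (τ : F) (i : ι) (l : Fin 1) (k : ι ⊕ Fin 1) :
    coordDeriv (b.prod c) univ (fun q => warpedCoeff κ f H q (Sum.inl i) (Sum.inr l)) k
      (u, τ) = 0 := coordDeriv_const _ 0 _ _

lemma coordDeriv_warpedCoeff_rl (u : E) (τ : F) (i : ι) (l : Fin 1) (k : ι ⊕ Fin 1) :
    coordDeriv (b.prod c) univ (fun q => warpedCoeff κ f H q (Sum.inr l) (Sum.inl i)) k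
      (u, τ) = 0 := coordDeriv_const _ 0 _ _

lemma coordDeriv_warpedCoeff_rr (u : E) (τ : F) (l l' : Fin 1) (k : ι ⊕ Fin 1) :
    coordDeriv (b.prod c) univ (fun q => warpedCoeff κ f H q (Sum.inr l) (Sum.inr l')) k
      (u, τ) = 0 := coordDeriv_const _ (κ * (1 : Matrix (Fin 1) (Fin 1) ℝ) l l') _ _

variable [Fintype ι] [DecidableEq ι]

/-- The Christoffel symbols of `κ dτ² + f(τ) H`, in terms of those of `H` and of the logarithmic
derivative `L = f' / (2 f)`; `i`, `j`, `k` stand for directions in the first factor. -/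
lemma christoffel_warpedCoeff (hκ : κ ≠ 0) {u : E} {τ : F}
    (hH : ∀ i j, DifferentiableAt ℝ (fun u => H u i j) u) (hf : DifferentiableAt ℝ f τ)
    (hf0 : f τ ≠ 0) (hdet : (H u).det ≠ 0) (hsymm : (H u).IsSymm)
    (hL : coordDeriv c univ f 0 τ = 2 * f τ * L τ) :
    (∀ k i j, christoffel (b.prod c) univ (warpedCoeff κ f H) (Sum.inl k) (Sum.inl i) (Sum.inl j)
      (u, τ) = christoffel b univ H k i j u) ∧
    (∀ i j, christoffel (b.prod c) univ (warpedCoeff κ f H) (Sum.inr 0) (Sum.inl i) (Sum.inl j)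
      (u, τ) = -(κ⁻¹ * (f τ * L τ)) * H u i j) ∧
    (∀ k i, christoffel (b.prod c) univ (warpedCoeff κ f H) (Sum.inl k) (Sum.inl i) (Sum.inr 0)
      (u, τ) = L τ * if k = i then 1 else 0) ∧
    (∀ k i, christoffel (b.prod c) univ (warpedCoeff κ f H) (Sum.inl k) (Sum.inr 0) (Sum.inl i)
      (u, τ) = L τ * if k = i then 1 else 0) ∧
    (∀ k, christoffel (b.prod c) univ (warpedCoeff κ f H) (Sum.inl k) (Sum.inr 0) (Sum.inr 0)
      (u, τ) = 0) ∧
    (∀ i, christoffel (b.prod c) univ (warpedCoeff κ f H) (Sum.inr 0) (Sum.inl i) (Sum.inr 0)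
      (u, τ) = 0) ∧
    (∀ i, christoffel (b.prod c) univ (warpedCoeff κ f H) (Sum.inr 0) (Sum.inr 0) (Sum.inl i)
      (u, τ) = 0) ∧
    christoffel (b.prod c) univ (warpedCoeff κ f H) (Sum.inr 0) (Sum.inr 0) (Sum.inr 0)
      (u, τ) = 0 := by
  have hinv := warpedCoeff_inv (q := (u, τ)) hκ hf0 hdet
  have hone : ∀ k i, ∑ l, (H u)⁻¹ k l * H u i l = if k = i then 1 else 0 := by
    intro k i
    rw [← Matrix.one_apply, ← Matrix.nonsing_inv_mul (H u) hdet.isUnit, Matrix.mul_apply]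
    exact Finset.sum_congr rfl fun l _ => by rw [hsymm.apply]
  have hone' : ∀ k i, 1 / 2 * ∑ l, (f τ)⁻¹ * (H u)⁻¹ k l * (2 * f τ * L τ * H u i l) =
      L τ * if k = i then 1 else 0 := by
    intro k i
    rw [← hone, Finset.mul_sum, Finset.mul_sum]
    exact Finset.sum_congr rfl fun l _ => by field_simp
  refine ⟨fun k i j => ?_, fun i j => ?_, fun k i => ?_, fun k i => ?_, fun k => ?_, fun i => ?_,
    fun i => ?_, ?_⟩
  all_goals
    simp only [christoffel, hinv, Fintype.sum_sum_type, Finset.univ_unique, Finset.sum_singleton,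
      Fin.default_eq_zero, Matrix.fromBlocks_apply₁₁, Matrix.fromBlocks_apply₁₂,
      Matrix.fromBlocks_apply₂₁, Matrix.fromBlocks_apply₂₂, Matrix.smul_apply, Matrix.zero_apply,
      Matrix.one_apply_eq, smul_eq_mul, zero_mul, add_zero, zero_add, sub_zero, mul_zero, mul_one,
      coordDeriv_warpedCoeff_inl b c hH hf, coordDeriv_warpedCoeff_inr b c hH hf,
      coordDeriv_warpedCoeff_lr, coordDeriv_warpedCoeff_rl, coordDeriv_warpedCoeff_rr,
      Finset.sum_const_zero, hL, hone']
  · congr 1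
    exact Finset.sum_congr rfl fun l _ => by field_simp
  · ring

/-- The scalar curvature of the warped product metric `κ dτ² + f(τ) H`, where `L = f' / (2 f)`. -/
theorem coordScalarCurvature_warpedCoeff (hκ : κ ≠ 0) (hU : IsOpen U) (hT : IsOpen T)
    (hH : ∀ i j, ContDiffOn ℝ ∞ (fun u => H u i j) U) (hdet : ∀ u ∈ U, (H u).det ≠ 0)
    (hsymm : ∀ u ∈ U, (H u).IsSymm) (hf : ContDiffOn ℝ ∞ f T) (hf0 : ∀ τ ∈ T, f τ ≠ 0)
    (hLs : ContDiffOn ℝ ∞ L T) (hL : ∀ τ ∈ T, coordDeriv c univ f 0 τ = 2 * f τ * L τ)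
    {u : E} {τ : F} (hu : u ∈ U) (hτ : τ ∈ T) :
    coordScalarCurvature (b.prod c) univ (warpedCoeff κ f H) (u, τ) =
      coordScalarCurvature b univ H u / f τ
        - Fintype.card ι / κ * (2 * coordDeriv c univ L 0 τ + (Fintype.card ι + 1) * L τ ^ 2) := by
  have dH : ∀ x ∈ U, ∀ i j, DifferentiableAt ℝ (fun u => H u i j) x := fun x hx i j =>
    ((hH i j).contDiffAt (hU.mem_nhds hx)).differentiableAt (by simp)
  have df : ∀ x ∈ T, DifferentiableAt ℝ f x := fun x hx =>
    (hf.contDiffAt (hT.mem_nhds hx)).differentiableAt (by simp)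
  have dL := (hLs.contDiffAt (hT.mem_nhds hτ)).differentiableAt (by simp)
  have dΓ := fun k i j => ((contDiffOn_christoffel b hU hH hdet k i j).contDiffAt
    (hU.mem_nhds hu)).differentiableAt (by simp)
  have hc := fun (q : E × F) (hq : q ∈ U ×ˢ T) => christoffel_warpedCoeff b c (L := L) hκ (u := q.1)
    (τ := q.2) (dH q.1 hq.1) (df q.2 hq.2) (hf0 q.2 hq.2) (hdet q.1 hq.1) (hsymm q.1 hq.1)
    (hL q.2 hq.2)
  have hW : U ×ˢ T ∈ 𝓝 (u, τ) := (hU.prod hT).mem_nhds ⟨hu, hτ⟩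
  -- The Christoffel symbols are products of functions of the two variables.
  have germ : ∀ {k i j : ι ⊕ Fin 1} {A : F → ℝ} {h : E → ℝ},
      (∀ q ∈ U ×ˢ T, christoffel (b.prod c) univ (warpedCoeff κ f H) k i j q = A q.2 * h q.1) →
      ∀ l, coordDeriv (b.prod c) univ (christoffel (b.prod c) univ (warpedCoeff κ f H) k i j) l
        (u, τ) = coordDeriv (b.prod c) univ (fun q : E × F => A q.2 * h q.1) l (u, τ) :=
    fun hq l => coordDeriv_congr _ (mem_univ _) (by
      rw [nhdsWithin_univ]
      exact Filter.eventually_of_mem hW hq) l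
  have germ0 : ∀ {k i j : ι ⊕ Fin 1},
      (∀ q ∈ U ×ˢ T, christoffel (b.prod c) univ (warpedCoeff κ f H) k i j q = 0) →
      ∀ l, coordDeriv (b.prod c) univ (christoffel (b.prod c) univ (warpedCoeff κ f H) k i j) l
        (u, τ) = 0 := fun hq l => by
    rw [coordDeriv_congr _ (mem_univ _) (f' := fun _ => 0) (by
      rw [nhdsWithin_univ]
      exact Filter.eventually_of_mem hW hq), coordDeriv_const]
  have g1 : ∀ k i j l, coordDeriv (b.prod c) univ (christoffel (b.prod c) univ (warpedCoeff κ f H)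
      (Sum.inl k) (Sum.inl i) (Sum.inl j)) (Sum.inl l) (u, τ) =
      coordDeriv b univ (christoffel b univ H k i j) l u := fun k i j l => by
    rw [germ (A := fun _ => 1) (h := christoffel b univ H k i j)
      (fun q hq => by rw [one_mul]; exact (hc q hq).1 k i j),
      coordDeriv_prod_inl b c (differentiableAt_const _) (dΓ k i j), one_mul]
  have g2 : ∀ i j, coordDeriv (b.prod c) univ (christoffel (b.prod c) univ (warpedCoeff κ f H)
      (Sum.inr 0) (Sum.inl i) (Sum.inl j)) (Sum.inr 0) (u, τ) =
      -(κ⁻¹ * (f τ * (2 * L τ ^ 2 + coordDeriv c univ L 0 τ))) * H u i j := fun i j => by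
    have hfL : DifferentiableAt ℝ (fun x => f x * L x) τ := (df τ hτ).fun_mul dL
    rw [germ (A := fun x => -κ⁻¹ * (f x * L x)) (h := fun u => H u i j)
      (fun q hq => by rw [neg_mul]; exact (hc q hq).2.1 i j),
      coordDeriv_prod_inr b c (hfL.const_mul _) (dH u hu i j),
      coordDeriv_mul c (differentiableAt_const _) hfL, coordDeriv_mul c (df τ hτ) dL,
      coordDeriv_const, hL τ hτ]
    ring
  have g3 : ∀ k i, coordDeriv (b.prod c) univ (christoffel (b.prod c) univ (warpedCoeff κ f H)
      (Sum.inl k) (Sum.inr 0) (Sum.inl i)) (Sum.inr 0) (u, τ) =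
      coordDeriv c univ L 0 τ * if k = i then 1 else 0 := fun k i => by
    rw [germ (A := L) (h := fun _ => if k = i then 1 else 0)
      (fun q hq => (hc q hq).2.2.2.1 k i),
      coordDeriv_prod_inr b c dL (differentiableAt_const _)]
  have g4 : ∀ i l, coordDeriv (b.prod c) univ (christoffel (b.prod c) univ (warpedCoeff κ f H)
      (Sum.inr 0) (Sum.inl i) (Sum.inr 0)) l (u, τ) = 0 := fun i =>
    germ0 fun q hq => (hc q hq).2.2.2.2.2.1 i
  have g5 : ∀ k l, coordDeriv (b.prod c) univ (christoffel (b.prod c) univ (warpedCoeff κ f H)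
      (Sum.inl k) (Sum.inr 0) (Sum.inr 0)) l (u, τ) = 0 := fun k =>
    germ0 fun q hq => (hc q hq).2.2.2.2.1 k
  have g6 : ∀ l, coordDeriv (b.prod c) univ (christoffel (b.prod c) univ (warpedCoeff κ f H)
      (Sum.inr 0) (Sum.inr 0) (Sum.inr 0)) l (u, τ) = 0 :=
    germ0 fun q hq => (hc q hq).2.2.2.2.2.2.2
  obtain ⟨c1, c2, c3, c4, c5, c6, c7, c8⟩ := hc (u, τ) ⟨hu, hτ⟩
  simp only at c1 c2 c3 c4 c5 c6 c7 c8
  have hs : ∀ i j, H u j i = H u i j := fun i j => (hsymm u hu).apply i j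
  have ric1 : ∀ i j, coordRicci (b.prod c) univ (warpedCoeff κ f H) (Sum.inl i) (Sum.inl j) (u, τ)
      = coordRicci b univ H i j u - κ⁻¹ * f τ * (coordDeriv c univ L 0 τ +
        Fintype.card ι * L τ ^ 2) * H u i j := by
    intro i j
    simp only [coordRicci, Fintype.sum_sum_type, Finset.univ_unique, Finset.sum_singleton,
      Fin.default_eq_zero, c1, c2, c3, c6, c7, c8, g1, g2, g4, Finset.sum_add_distrib,
      Finset.sum_sub_distrib, mul_zero, zero_mul, add_zero, mul_ite, ite_mul, mul_one,
      Finset.sum_ite_eq', Finset.mem_univ, if_true, Finset.sum_const,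
      Finset.card_univ, nsmul_eq_mul, hs i j]
    ring
  have ric2 : coordRicci (b.prod c) univ (warpedCoeff κ f H) (Sum.inr 0) (Sum.inr 0) (u, τ)
      = -(Fintype.card ι * (coordDeriv c univ L 0 τ + L τ ^ 2)) := by
    simp only [coordRicci, Fintype.sum_sum_type, Finset.univ_unique, Finset.sum_singleton,
      Fin.default_eq_zero, c4, c5, c7, c8, g3, g5, g6, Finset.sum_add_distrib,
      Finset.sum_sub_distrib, mul_zero, zero_mul, add_zero, mul_ite, ite_mul, mul_one,
      Finset.sum_ite_eq', Finset.mem_univ, if_true, Finset.sum_const,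
      Finset.card_univ, nsmul_eq_mul]
    ring
  have htr : ∑ i, ∑ j, (H u)⁻¹ i j * H u i j = Fintype.card ι := by
    have : ∀ i, ∑ j, (H u)⁻¹ i j * H u i j = 1 := by
      intro i
      rw [← Matrix.one_apply_eq i, ← Matrix.nonsing_inv_mul (H u) (hdet u hu).isUnit,
        Matrix.mul_apply]
      exact Finset.sum_congr rfl fun l _ => by rw [hs]
    simp [this]
  rw [coordScalarCurvature, warpedCoeff_inv (q := (u, τ)) hκ (hf0 τ hτ) (hdet u hu)]
  simp only [Fintype.sum_sum_type, Finset.univ_unique, Finset.sum_singleton,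
    Fin.default_eq_zero, Matrix.fromBlocks_apply₁₁, Matrix.fromBlocks_apply₁₂,
    Matrix.fromBlocks_apply₂₁, Matrix.fromBlocks_apply₂₂, Matrix.smul_apply, Matrix.zero_apply,
    Matrix.one_apply_eq, smul_eq_mul, zero_mul, add_zero, zero_add, mul_one,
    Finset.sum_const_zero, ric1, ric2]
  have hsum : ∑ i, ∑ j, (f τ)⁻¹ * (H u)⁻¹ i j * (coordRicci b univ H i j u -
      κ⁻¹ * f τ * (coordDeriv c univ L 0 τ + Fintype.card ι * L τ ^ 2) * H u i j) =
      coordScalarCurvature b univ H u / f τ -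
      κ⁻¹ * (coordDeriv c univ L 0 τ + Fintype.card ι * L τ ^ 2) *
        ∑ i, ∑ j, (H u)⁻¹ i j * H u i j := by
    simp only [coordScalarCurvature, Finset.mul_sum, Finset.sum_div, ← Finset.sum_sub_distrib]
    refine Finset.sum_congr rfl fun i _ => Finset.sum_congr rfl fun j _ => ?_
    have := hf0 τ hτ
    field_simp
  rw [hsum, htr]
  field_simp
  ring

end Christoffel
end Warped

/-! ### The warped product metric on a band -/

section Band
open Topology Filter

variable {E H M : Type*} [NormedAddCommGroup E] [NormedSpace ℝ E] [TopologicalSpace H]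
  {I : ModelWithCorners ℝ E H} [TopologicalSpace M] [ChartedSpace H M]

/-- The derivative of a change of product charts. -/
lemma tangentCoordChange_prod {E' H' M' : Type*} [NormedAddCommGroup E'] [NormedSpace ℝ E']
    [TopologicalSpace H'] {J : ModelWithCorners ℝ E' H'} [TopologicalSpace M'] [ChartedSpace H' M']
    [IsManifold I 1 M] [IsManifold J 1 M'] {z x : M × M'} (h1 : x.1 ∈ (chartAt H z.1).source)
    (h2 : x.2 ∈ (chartAt H' z.2).source) :
    tangentCoordChange (I.prod J) z x x =
      (tangentCoordChange I z.1 x.1 x.1).prodMap (tangentCoordChange J z.2 x.2 x.2) := by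
  have h1 := hasFDerivWithinAt_tangentCoordChange (I := I) (x := z.1) (y := x.1) (z := x.1)
    (by simpa using h1)
  have h2 := hasFDerivWithinAt_tangentCoordChange (I := J) (x := z.2) (y := x.2) (z := x.2)
    (by simpa using h2)
  have hu : UniqueDiffWithinAt ℝ (range I ×ˢ range J) (extChartAt I z.1 x.1, extChartAt J z.2 x.2) :=
    I.uniqueDiffOn.prod J.uniqueDiffOn _ ⟨mem_range_self _, mem_range_self _⟩
  rw [tangentCoordChange_def]
  have e1 : range (I.prod J) = range I ×ˢ range J := by
    rw [modelWithCorners_prod_coe]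
    exact range_prodMap
  have e2 : extChartAt (I.prod J) x ∘ (extChartAt (I.prod J) z).symm =
      Prod.map (extChartAt I x.1 ∘ (extChartAt I z.1).symm)
        (extChartAt J x.2 ∘ (extChartAt J z.2).symm) := by
    rw [extChartAt_prod, extChartAt_prod]
    rfl
  have e3 : extChartAt (I.prod J) z x = (extChartAt I z.1 x.1, extChartAt J z.2 x.2) := by
    rw [extChartAt_prod]
    rfl
  rw [e1, e2, e3]
  exact (HasFDerivWithinAt.prodMap (p := (extChartAt I z.1 x.1, extChartAt J z.2 x.2))
    (h1.mono (fst_image_prod_subset _ _)) (h2.mono (snd_image_prod_subset _ _))).fderivWithin hu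

variable [IsManifold I ∞ M]

lemma mfderiv_extChartAt_frameMap {z x : M} (hx : x ∈ (chartAt H z).source) (v : E) :
    mfderiv I 𝓘(ℝ, E) (extChartAt I z) x (frameMap I z x v) = v := by
  have : IsManifold I 1 M := .of_le (n := ∞) (by exact_mod_cast le_top)
  rw [← TangentBundle.continuousLinearMapAt_trivializationAt hx]
  exact (trivializationAt E (TangentSpace I) z).continuousLinearMapAt_symmL (by simpa using hx) v

lemma frameMap_prod {E' H' M' : Type*} [NormedAddCommGroup E'] [NormedSpace ℝ E']
    [TopologicalSpace H'] {J : ModelWithCorners ℝ E' H'} [TopologicalSpace M'] [ChartedSpace H' M']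
    [IsManifold J ∞ M'] {z x : M × M'} (h1 : x.1 ∈ (chartAt H z.1).source)
    (h2 : x.2 ∈ (chartAt H' z.2).source) (v : E × E') :
    frameMap (I.prod J) z x v = (frameMap I z.1 x.1 v.1, frameMap J z.2 x.2 v.2) := by
  have : IsManifold I 1 M := .of_le (n := ∞) (by exact_mod_cast le_top)
  have : IsManifold J 1 M' := .of_le (n := ∞) (by exact_mod_cast le_top)
  have : IsManifold (I.prod J) 1 (M × M') := .of_le (n := ∞) (by exact_mod_cast le_top)
  have hx : x ∈ (chartAt (ModelProd H H') z).source := ⟨h1, h2⟩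
  rw [frameMap_eq_tangentCoordChange hx, frameMap_eq_tangentCoordChange h1,
    frameMap_eq_tangentCoordChange h2, tangentCoordChange_prod h1 h2]
  rfl

/-- The orientation, with respect to the standard one of `[-1, 1]`, of the chart at `z`. -/
def intervalSign (z : Icc (-1 : ℝ) 1) : ℝ := if (z : ℝ) < 1 then 1 else -1

lemma intervalSign_sq (z : Icc (-1 : ℝ) 1) : intervalSign z ^ 2 = 1 := by
  unfold intervalSign; split_ifs <;> norm_num

/-- The affine extension of the inverse of the chart at `z` of `[-1, 1]`. -/
def intervalCoord (z : Icc (-1 : ℝ) 1) (τ : EuclideanSpace ℝ (Fin 1)) : ℝ :=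
  intervalSign z * (τ 0 - 1)

lemma intervalCoord_extChartAt (z t : Icc (-1 : ℝ) 1) :
    intervalCoord z (extChartAt (𝓡∂ 1) z t) = t := by
  unfold intervalCoord intervalSign
  split_ifs with h <;>
  simp [extChartAt, h, IccLeftChart_apply, IccRightChart_apply,
    modelWithCornersEuclideanHalfSpace_toFun]

lemma contDiff_intervalCoord (z : Icc (-1 : ℝ) 1) : ContDiff ℝ ∞ (intervalCoord z) := by
  unfold intervalCoord
  fun_prop

lemma hasFDerivAt_intervalCoord (z : Icc (-1 : ℝ) 1) (τ : EuclideanSpace ℝ (Fin 1)) :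
    HasFDerivAt (intervalCoord z)
      (intervalSign z • (EuclideanSpace.proj (0 : Fin 1) : EuclideanSpace ℝ (Fin 1) →L[ℝ] ℝ)) τ := by
  have h := (EuclideanSpace.proj (0 : Fin 1) : EuclideanSpace ℝ (Fin 1) →L[ℝ] ℝ).hasFDerivAt (x := τ)
  exact (h.sub_const 1).const_mul (intervalSign z)

/-- The differential of the inclusion `[-1, 1] → ℝ`. -/
def intervalForm (t : Icc (-1 : ℝ) 1) : EuclideanSpace ℝ (Fin 1) →L[ℝ] ℝ :=
  mfderiv (𝓡∂ 1) 𝓘(ℝ) (Subtype.val : Icc (-1 : ℝ) 1 → ℝ) t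

lemma intervalForm_frameMap {z t : Icc (-1 : ℝ) 1}
    (ht : t ∈ (chartAt (EuclideanHalfSpace 1) z).source) (v : EuclideanSpace ℝ (Fin 1)) :
    intervalForm t (frameMap (𝓡∂ 1) z t v) = intervalSign z * v 0 := by
  have e : (Subtype.val : Icc (-1 : ℝ) 1 → ℝ) = intervalCoord z ∘ extChartAt (𝓡∂ 1) z :=
    funext fun t => (intervalCoord_extChartAt z t).symm
  have h := (hasFDerivAt_intervalCoord z (extChartAt (𝓡∂ 1) z t)).hasMFDerivAt.comp t
    (mdifferentiableAt_extChartAt ht).hasMFDerivAt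
  rw [← e] at h
  have h2 : intervalForm t (frameMap (𝓡∂ 1) z t v) =
      (intervalSign z • (EuclideanSpace.proj (0 : Fin 1) : EuclideanSpace ℝ (Fin 1) →L[ℝ] ℝ))
        (mfderiv (𝓡∂ 1) 𝓘(ℝ, EuclideanSpace ℝ (Fin 1)) (extChartAt (𝓡∂ 1) z) t
          (frameMap (𝓡∂ 1) z t v)) := by
    rw [intervalForm, h.mfderiv]
    rfl
  exact h2.trans (congrArg (intervalSign z •
    (EuclideanSpace.proj (0 : Fin 1) : EuclideanSpace ℝ (Fin 1) →L[ℝ] ℝ))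
    (mfderiv_extChartAt_frameMap ht v))

lemma intervalForm_injective (t : Icc (-1 : ℝ) 1) {v : EuclideanSpace ℝ (Fin 1)}
    (hv : intervalForm t v = 0) : v = 0 := by
  have ht := mem_chart_source (EuclideanHalfSpace 1) t
  have : IsManifold (𝓡∂ 1) 1 (Icc (-1 : ℝ) 1) := .of_le (n := ∞) (by exact_mod_cast le_top)
  have hs : ∀ v, frameMap (𝓡∂ 1) t t v = v := fun v => by
    rw [frameMap_eq_tangentCoordChange ht]
    exact tangentCoordChange_self (E := EuclideanSpace ℝ (Fin 1)) (by rwa [extChartAt_source])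
  have h := intervalForm_frameMap ht v
  rw [hs] at h
  have h0 : intervalSign t ≠ 0 := fun h0 => by simpa [h0] using intervalSign_sq t
  have : v 0 = 0 := by
    rcases mul_eq_zero.1 (h.symm.trans hv) with h | h
    · exact absurd h h0
    · exact h
  ext i
  rw [Subsingleton.elim i 0, this]
  rfl

/-- The metric at `x`, as a bilinear form on the model space. -/
def SmoothMetric.form (h : SmoothMetric I M) (x : M) : E →L[ℝ] E →L[ℝ] ℝ := h.inner x

/-- The bilinear form `φ h + κ ℓ ⊗ ℓ` on a product. -/
def warpedForm {E F : Type*} [NormedAddCommGroup E] [NormedSpace ℝ E] [NormedAddCommGroup F]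
    [NormedSpace ℝ F] (φ κ : ℝ) (h : E →L[ℝ] E →L[ℝ] ℝ) (ℓ : F →L[ℝ] ℝ) :
    E × F →L[ℝ] E × F →L[ℝ] ℝ :=
  φ • h.bilinearComp (ContinuousLinearMap.fst ℝ E F) (ContinuousLinearMap.fst ℝ E F) +
    κ • (ℓ ∘L ContinuousLinearMap.snd ℝ E F).smulRight (ℓ ∘L ContinuousLinearMap.snd ℝ E F)

lemma warpedForm_apply {E F : Type*} [NormedAddCommGroup E] [NormedSpace ℝ E]
    [NormedAddCommGroup F] [NormedSpace ℝ F] (φ κ : ℝ) (h : E →L[ℝ] E →L[ℝ] ℝ) (ℓ : F →L[ℝ] ℝ)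
    (v w : E × F) : warpedForm φ κ h ℓ v w = φ * h v.1 w.1 + κ * (ℓ v.2 * ℓ w.2) := rfl

lemma warpedForm_pos (h : SmoothMetric I M) {φ κ : ℝ} (hφ : 0 < φ) (hκ : 0 < κ) (y : M)
    (t : Icc (-1 : ℝ) 1) (v : E × EuclideanSpace ℝ (Fin 1)) (hv : v ≠ 0) :
    0 < warpedForm φ κ (h.form y) (intervalForm t) v v := by
  rw [warpedForm_apply]
  by_cases h1 : v.1 = 0
  · have h2 : intervalForm t v.2 ≠ 0 := fun h2 => hv (Prod.ext h1 (intervalForm_injective t h2))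
    rw [h1, map_zero, mul_zero, zero_add]
    exact mul_pos hκ (mul_self_pos.2 h2)
  · have h2 : 0 < (h.form y) v.1 v.1 := h.pos y v.1 h1
    have := mul_self_nonneg (intervalForm t v.2)
    positivity

/-- The warped product metric `κ ds² + φ(s) h` on `M × [-1, 1]`. -/
def SmoothMetric.band [FiniteDimensional ℝ E] (h : SmoothMetric I M) {T : Set ℝ} (hT : IsOpen T)
    (hIT : Icc (-1) 1 ⊆ T) {φ : ℝ → ℝ} (hφ : ContDiffOn ℝ ∞ φ T) (hφ0 : ∀ s ∈ T, 0 < φ s) {κ : ℝ}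
    (hκ : 0 < κ) : SmoothMetric (I.prod (𝓡∂ 1)) (M × Icc (-1 : ℝ) 1) where
  inner p := warpedForm (φ p.2) κ (h.form p.1) (intervalForm p.2)
  symm p v w := by
    have := h.symm p.1 v.1 w.1
    exact congrArg₂ (fun a c => φ p.2 * a + κ * c) this (mul_comm _ _)
  pos p v hv := warpedForm_pos h (hφ0 _ (hIT p.2.2)) hκ p.1 p.2 v hv
  isVonNBounded p := isVonNBounded_tangentSpace_of_pos p
    (warpedForm (φ p.2) κ (h.form p.1) (intervalForm p.2))
    fun v hv => warpedForm_pos h (hφ0 _ (hIT p.2.2)) hκ p.1 p.2 v hv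
  contMDiff z := by
    refine (contMDiffAt_bilin_section_iff (I := I.prod (𝓡∂ 1)) (fun p : M × Icc (-1 : ℝ) 1 =>
      warpedForm (φ p.2) κ (h.form p.1) (intervalForm p.2)) z z
      (mem_chart_source _ z)).2 fun v w => ?_
    have h1 : ContMDiffAt (I.prod (𝓡∂ 1)) 𝓘(ℝ) ∞ (fun p : M × Icc (-1 : ℝ) 1 => φ p.2) z :=
      ((hφ.contDiffAt (hT.mem_nhds (hIT z.2.2))).contMDiffAt.comp z.2
        contMDiff_subtypeVal_Icc.contMDiffAt).comp z contMDiffAt_snd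
    have h2 := ((contMDiffAt_bilin_section_iff h.inner z.1 z.1 (mem_chart_source _ _)).1
      (h.contMDiff z.1) v.1 w.1).comp z (contMDiffAt_fst (J := 𝓡∂ 1))
    refine ((h1.mul h2).add (contMDiffAt_const
      (c := κ * (intervalSign z.2 * v.2 0 * (intervalSign z.2 * w.2 0))))).congr_of_eventuallyEq ?_
    filter_upwards [(chartAt (ModelProd H (EuclideanHalfSpace 1)) z).open_source.mem_nhds
      (mem_chart_source _ z)] with p hp
    have hp2 : p.2 ∈ (chartAt (EuclideanHalfSpace 1) z.2).source := hp.2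
    rw [frameMap_prod hp.1 hp.2, frameMap_prod hp.1 hp.2]
    refine (warpedForm_apply _ _ _ _ _ _).trans ?_
    simp only [intervalForm_frameMap hp2]
    rfl

end Band

/-! ### Scalar curvature of the band -/

section BandCurvature
open Topology Filter

variable {E H M : Type*} [NormedAddCommGroup E] [NormedSpace ℝ E] [FiniteDimensional ℝ E]
  [TopologicalSpace H] {I : ModelWithCorners ℝ E H} [TopologicalSpace M] [ChartedSpace H M]
  [IsManifold I ∞ M] {ι : Type*} (b : Module.Basis ι ℝ E)
  (h : SmoothMetric I M) {T : Set ℝ} (hT : IsOpen T) (hIT : Icc (-1) 1 ⊆ T) {φ : ℝ → ℝ}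
  (hφ : ContDiffOn ℝ ∞ φ T) (hφ0 : ∀ s ∈ T, 0 < φ s) {κ : ℝ} (hκ : 0 < κ)

/-- In product charts the metric `κ ds² + φ(s) h` has the coefficients of a warped product. -/
lemma SmoothMetric.chartCoeff_band (z : M × Icc (-1 : ℝ) 1)
    {u : E × EuclideanSpace ℝ (Fin 1)} (hu : u ∈ (extChartAt (I.prod (𝓡∂ 1)) z).target) :
    (h.band hT hIT hφ hφ0 hκ).chartCoeff
      (b.prod (EuclideanSpace.basisFun (Fin 1) ℝ).toBasis) z u =
      warpedCoeff κ (fun τ => φ (intervalCoord z.2 τ)) (h.chartCoeff b z.1) u := by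
  set p := (extChartAt (I.prod (𝓡∂ 1)) z).symm u with hp
  have hup : u = extChartAt (I.prod (𝓡∂ 1)) z p :=
    ((extChartAt (I.prod (𝓡∂ 1)) z).right_inv hu).symm
  have hps : p ∈ (chartAt (ModelProd H (EuclideanHalfSpace 1)) z).source := by
    rw [← extChartAt_source (I.prod (𝓡∂ 1))]
    exact (extChartAt (I.prod (𝓡∂ 1)) z).map_target hu
  have hp1 : p.1 ∈ (chartAt H z.1).source := hps.1
  have hp2 : p.2 ∈ (chartAt (EuclideanHalfSpace 1) z.2).source := hps.2
  have hu1 : u.1 = extChartAt I z.1 p.1 := by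
    rw [hup, extChartAt_prod]
    rfl
  have hu2 : intervalCoord z.2 u.2 = p.2 := by
    rw [← intervalCoord_extChartAt z.2 p.2, hup, extChartAt_prod]
    rfl
  have happ : ∀ v w, (h.band hT hIT hφ hφ0 hκ).inner p (frameMap (I.prod (𝓡∂ 1)) z p v)
      (frameMap (I.prod (𝓡∂ 1)) z p w) =
      φ p.2 * h.inner p.1 (frameMap I z.1 p.1 v.1) (frameMap I z.1 p.1 w.1) +
        κ * (v.2 0 * w.2 0) := by
    intro v w
    rw [frameMap_prod hp1 hp2, frameMap_prod hp1 hp2]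
    refine (warpedForm_apply _ _ _ _ _ _).trans ?_
    simp only [intervalForm_frameMap hp2]
    rw [mul_mul_mul_comm, ← sq, intervalSign_sq, one_mul]
    rfl
  ext i j
  rw [hup, chartCoeff_apply _ _ _ _ hps, happ, ← hup]
  rcases i with i | i <;> rcases j with j | j
  · rw [warpedCoeff, Matrix.fromBlocks_apply₁₁, Matrix.smul_apply, hu2, hu1,
      chartCoeff_apply _ _ _ _ hp1]
    simp
  · simp [warpedCoeff]
  · simp [warpedCoeff]
  · simp [warpedCoeff, Subsingleton.elim i 0, Subsingleton.elim j 0]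

/-- The scalar curvature of `κ ds² + φ(s) h`, where `L = φ' / (2 φ)`. -/
theorem SmoothMetric.scalarCurvature_band [I.Boundaryless] [Fintype ι] [DecidableEq ι] {L : ℝ → ℝ}
    (hL : ContDiffOn ℝ ∞ L T) (hφL : ∀ s ∈ T, deriv φ s = 2 * φ s * L s)
    (z : M × Icc (-1 : ℝ) 1) :
    (h.band hT hIT hφ hφ0 hκ).scalarCurvature
      (b.prod (EuclideanSpace.basisFun (Fin 1) ℝ).toBasis) z =
      h.scalarCurvature b z.1 / φ z.2 -
        Fintype.card ι / κ * (2 * deriv L z.2 + (Fintype.card ι + 1) * L z.2 ^ 2) := by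
  have hr : range (I.prod (𝓡∂ 1)) = (univ : Set E) ×ˢ range (𝓡∂ 1) := by
    rw [← I.range_eq_univ, modelWithCorners_prod_coe]
    exact range_prodMap
  set c := (EuclideanSpace.basisFun (Fin 1) ℝ).toBasis with hc
  set A := intervalCoord z.2 with hA
  set T' := A ⁻¹' T with hT'
  have hAs := contDiff_intervalCoord z.2
  have hTo : IsOpen T' := hT.preimage hAs.continuous
  set U := (extChartAt I z.1).target with hU
  have hUo : IsOpen U := isOpen_extChartAt_target z.1
  set u₀ := extChartAt I z.1 z.1 with hu₀
  set τ₀ := extChartAt (𝓡∂ 1) z.2 z.2 with hτ₀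
  have hz : extChartAt (I.prod (𝓡∂ 1)) z z = (u₀, τ₀) := by
    rw [extChartAt_prod]
    rfl
  have hAτ : A τ₀ = z.2 := intervalCoord_extChartAt z.2 z.2
  have hu₀U : u₀ ∈ U := mem_extChartAt_target z.1
  have hτ₀T : τ₀ ∈ T' := by
    rw [hT', mem_preimage, hAτ]
    exact hIT z.2.2
  have hder : ∀ {ψ : ℝ → ℝ}, ContDiffOn ℝ ∞ ψ T → ∀ τ ∈ T',
      coordDeriv c univ (fun τ => ψ (A τ)) 0 τ = intervalSign z.2 * deriv ψ (A τ) := by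
    intro ψ hψ τ hτ
    have h1 := ((hψ.contDiffAt (hT.mem_nhds hτ)).differentiableAt (by simp)).hasDerivAt
    have h2 := h1.comp_hasFDerivAt τ (hasFDerivAt_intervalCoord z.2 τ)
    refine (HasFDerivAt.coordDeriv_eq c h2 0).trans ?_
    simp [hc, mul_comm]
  have hcomp : ∀ {ψ : ℝ → ℝ}, ContDiffOn ℝ ∞ ψ T → ContDiffOn ℝ ∞ (fun τ => ψ (A τ)) T' :=
    fun hψ => hψ.comp hAs.contDiffOn fun τ hτ => hτ
  have hdet : ∀ u ∈ U, (h.chartCoeff b z.1 u).det ≠ 0 := fun u hu =>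
    h.chartCoeff_det_ne_zero b z.1 hu
  have hφ0' : ∀ τ ∈ T', φ (A τ) ≠ 0 := fun τ hτ => (hφ0 _ hτ).ne'
  -- In these coordinates the metric extends smoothly across the boundary.
  rw [SmoothMetric.scalarCurvature, hz, coordScalarCurvature_congr
    (G' := warpedCoeff κ (fun τ => φ (A τ)) (h.chartCoeff b z.1)), hr,
    coordScalarCurvature_eq_univ (W := U ×ˢ T')]
  · rw [coordScalarCurvature_warpedCoeff b c (L := fun τ => intervalSign z.2 * L (A τ)) hκ.ne' hUo
      hTo (h.contDiffOn_chartCoeff b z.1) hdet (fun u _ => Matrix.IsSymm.ext fun i j => h.symm _ _ _)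
      (hcomp hφ) hφ0' (contDiffOn_const.mul (hcomp hL)) _ hu₀U hτ₀T]
    · have hd : DifferentiableAt ℝ (fun τ => L (A τ)) τ₀ :=
        ((hcomp hL).contDiffAt (hTo.mem_nhds hτ₀T)).differentiableAt (by simp)
      have h1 := intervalSign_sq z.2
      rw [coordDeriv_mul c (differentiableAt_const _) hd, hder hL τ₀ hτ₀T, coordDeriv_const, hAτ,
        SmoothMetric.scalarCurvature, I.range_eq_univ, mul_pow, h1]
      have h2 : intervalSign z.2 * (intervalSign z.2 * deriv L z.2) = deriv L z.2 := by
        rw [← mul_assoc, ← sq, h1, one_mul]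
      rw [h2]
      ring
    · intro τ hτ
      rw [hder hφ τ hτ, hφL _ hτ]
      ring
  · exact uniqueDiffOn_univ.prod (𝓡∂ 1).uniqueDiffOn
  · exact hUo.prod hTo
  · exact contDiffOn_warpedCoeff (h.contDiffOn_chartCoeff b z.1) (hcomp hφ)
  · exact fun u hu => warpedCoeff_det_ne_zero hκ.ne' (hφ0' u.2 hu.2) (hdet u.1 hu.1)
  · exact ⟨mem_univ _, mem_range_self _⟩
  · exact ⟨hu₀U, hτ₀T⟩
  · rw [← hz]
    exact mem_range_self _
  · rw [← hz]
    filter_upwards [extChartAt_target_mem_nhdsWithin (I := I.prod (𝓡∂ 1)) z] with u hu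
    exact h.chartCoeff_band b hT hIT hφ hφ0 hκ z hu

end BandCurvature

/-! ### The distance between the boundary components -/

section Distance
open Topology Filter MeasureTheory

variable {E H M : Type*} [NormedAddCommGroup E] [NormedSpace ℝ E] [TopologicalSpace H]
  {I : ModelWithCorners ℝ E H} [TopologicalSpace M] [ChartedSpace H M] [IsManifold I ∞ M]

/-- The norm that `g` induces on the tangent spaces. -/
lemma SmoothMetric.norm_sq_eq (g : SmoothMetric I M) (x : M) (v : TangentSpace I x) :
    let : Bundle.RiemannianBundle (fun x : M => TangentSpace I x) := ⟨g.toRiemannianMetric⟩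
    ‖v‖ ^ 2 = g.inner x v v := by
  intro inst
  exact (real_inner_self_eq_norm_sq v).symm

/-- A function whose differential has norm at most one for `g` is `1`-Lipschitz for the
Riemannian distance. -/
lemma SmoothMetric.le_edist (g : SmoothMetric I M) {f : M → ℝ} (hf : ContMDiff I 𝓘(ℝ) 1 f)
    {ℓ : ∀ x, TangentSpace I x →L[ℝ] ℝ} (hℓ : ∀ x, HasMFDerivAt I 𝓘(ℝ) f x (ℓ x))
    (hg : ∀ x v, ℓ x v ^ 2 ≤ g.inner x v v) (x y : M) :
    ENNReal.ofReal |f y - f x| ≤ g.edist x y := by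
  let : Bundle.RiemannianBundle (fun x : M => TangentSpace I x) := ⟨g.toRiemannianMetric⟩
  refine le_of_forall_gt fun r hr => ?_
  obtain ⟨γ, hγ0, hγ1, hγ, hlen⟩ := Manifold.exists_lt_of_riemannianEDist_lt (I := I) hr
  refine lt_of_le_of_lt ?_ hlen
  have hfγ : ContDiffOn ℝ 1 (f ∘ γ) (Icc 0 1) := by
    rw [← contMDiffOn_iff_contDiffOn]
    exact hf.comp_contMDiffOn hγ
  have h1 := enorm_sub_le_lintegral_derivWithin_Icc_of_contDiffOn_Icc hfγ zero_le_one
  simp only [Function.comp_apply, hγ0, hγ1, Real.enorm_eq_ofReal_abs] at h1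
  refine h1.trans ?_
  rw [Manifold.pathELength_eq_lintegral_mfderivWithin_Icc]
  refine setLIntegral_mono' measurableSet_Icc fun t ht => ?_
  have hd : derivWithin (f ∘ γ) (Icc 0 1) t =
      ℓ (γ t) (mfderivWithin 𝓘(ℝ) I γ (Icc 0 1) t 1) := by
    have hc := (hℓ (γ t)).comp_hasMFDerivWithinAt t
      (hγ.mdifferentiableOn one_ne_zero t ht).hasMFDerivWithinAt
    rw [← fderivWithin_derivWithin, ← mfderivWithin_eq_fderivWithin,
      hc.mfderivWithin (uniqueDiffOn_Icc zero_lt_one t ht).uniqueMDiffWithinAt]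
    rfl
  rw [← ofReal_norm]
  refine ENNReal.ofReal_le_ofReal (abs_le_of_sq_le_sq ?_ (norm_nonneg _))
  rw [hd, g.norm_sq_eq]
  exact hg _ _

lemma SmoothMetric.edist_le (g : SmoothMetric I M) {γ : ℝ → M} {a b C : ℝ} (hab : a ≤ b)
    (hC : 0 ≤ C) (hγ : ContMDiffOn 𝓘(ℝ) I 1 γ (Icc a b))
    (hg : ∀ t ∈ Icc a b, g.inner (γ t) (mfderivWithin 𝓘(ℝ) I γ (Icc a b) t 1)
      (mfderivWithin 𝓘(ℝ) I γ (Icc a b) t 1) ≤ C ^ 2) :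
    g.edist (γ a) (γ b) ≤ ENNReal.ofReal (C * (b - a)) := by
  let : Bundle.RiemannianBundle (fun x : M => TangentSpace I x) := ⟨g.toRiemannianMetric⟩
  refine (Manifold.riemannianEDist_le_pathELength (I := I) hγ rfl rfl hab).trans ?_
  rw [Manifold.pathELength_eq_lintegral_mfderivWithin_Icc, ENNReal.ofReal_mul hC,
    ← Real.volume_Icc, ← setLIntegral_const]
  refine setLIntegral_mono' measurableSet_Icc fun t ht => ?_
  rw [← ofReal_norm]
  refine ENNReal.ofReal_le_ofReal (le_of_sq_le_sq ?_ hC)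
  rw [g.norm_sq_eq]
  exact hg t ht

variable [FiniteDimensional ℝ E]
  (h : SmoothMetric I M) {T : Set ℝ} (hT : IsOpen T) (hIT : Icc (-1) 1 ⊆ T) {φ : ℝ → ℝ}
  (hφ : ContDiffOn ℝ ∞ φ T) (hφ0 : ∀ s ∈ T, 0 < φ s) {κ : ℝ} (hκ : 0 < κ)

/-- The two boundary components of the band lie at distance `2 √κ`. -/
theorem SmoothMetric.setEDist_band [Nonempty M] :
    (h.band hT hIT hφ hφ0 hκ).setEDist {p | (p.2 : ℝ) = -1} {p | (p.2 : ℝ) = 1} =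
      ENNReal.ofReal (2 * √κ) := by
  refine le_antisymm ?_ (le_iInf₂ fun x hx => le_iInf₂ fun y hy => ?_)
  · obtain ⟨y⟩ := ‹Nonempty M›
    let γ : ℝ → M × Icc (-1 : ℝ) 1 := fun s => (y, projIcc (-1) 1 (by norm_num) s)
    have hγ : ContMDiffOn 𝓘(ℝ) (I.prod (𝓡∂ 1)) 1 γ (Icc (-1) 1) :=
      contMDiffOn_const.prodMk contMDiffOn_projIcc
    have hle := (h.band hT hIT hφ hφ0 hκ).edist_le (γ := γ) (C := √κ) (by norm_num : (-1 : ℝ) ≤ 1)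
      (Real.sqrt_nonneg _) hγ ?_
    · rw [show √κ * (1 - -1) = 2 * √κ by ring] at hle
      refine le_trans (iInf₂_le_of_le (γ (-1)) ?_ (iInf₂_le_of_le (γ 1) ?_ le_rfl)) hle
      · simp [γ]
      · simp [γ]
    · intro t ht
      have hd : mfderivWithin 𝓘(ℝ) (I.prod (𝓡∂ 1)) γ (Icc (-1) 1) t 1 =
          ((0, mfderivWithin 𝓘(ℝ) (𝓡∂ 1) (projIcc (-1 : ℝ) 1 (by norm_num)) (Icc (-1) 1) t 1) :
            E × EuclideanSpace ℝ (Fin 1)) := by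
        rw [mfderivWithin_prodMk mdifferentiableWithinAt_const
          ((contMDiffOn_projIcc t ht).mdifferentiableWithinAt one_ne_zero)
          (uniqueDiffOn_Icc (by norm_num) t ht).uniqueMDiffWithinAt, mfderivWithin_const]
        rfl
      have h1 : intervalForm (γ t).2
          (mfderivWithin 𝓘(ℝ) (𝓡∂ 1) (projIcc (-1 : ℝ) 1 (by norm_num)) (Icc (-1) 1) t 1) = 1 := by
        rw [mfderivWithin_projIcc_one ht]
        exact mfderiv_subtypeVal_Icc_one _
      rw [hd]
      refine (warpedForm_apply _ _ _ _ _ _).le.trans ?_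
      rw [h1, map_zero, mul_zero, Real.sq_sqrt hκ.le, zero_add, mul_one, mul_one]
  · have hf : ContMDiff (I.prod (𝓡∂ 1)) 𝓘(ℝ) 1 (fun p : M × Icc (-1 : ℝ) 1 => √κ * (p.2 : ℝ)) :=
      contMDiff_const.mul (contMDiff_subtypeVal_Icc.comp contMDiff_snd)
    have hℓ : ∀ p : M × Icc (-1 : ℝ) 1, HasMFDerivAt (I.prod (𝓡∂ 1)) 𝓘(ℝ)
        (fun p : M × Icc (-1 : ℝ) 1 => √κ * (p.2 : ℝ)) p
        (√κ • (intervalForm p.2 ∘L ContinuousLinearMap.snd ℝ E (EuclideanSpace ℝ (Fin 1)))) := by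
      intro p
      have h1 : HasMFDerivAt (𝓡∂ 1) 𝓘(ℝ) (Subtype.val : Icc (-1 : ℝ) 1 → ℝ) p.2
          (intervalForm p.2) :=
        (contMDiff_subtypeVal_Icc.mdifferentiableAt (n := 1) one_ne_zero).hasMFDerivAt
      exact (h1.comp p (hasMFDerivAt_snd p)).const_smul √κ
    refine le_trans (le_of_eq ?_) ((h.band hT hIT hφ hφ0 hκ).le_edist hf hℓ ?_ x y)
    · rw [mem_ofPred_eq] at hx hy
      rw [hx, hy, show √κ * 1 - √κ * -1 = 2 * √κ by ring, abs_of_nonneg (by positivity)]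
    · intro p v
      refine le_trans ?_ (warpedForm_apply _ _ _ _ _ _).ge
      have h1 : 0 ≤ h.form p.1 (v : E × EuclideanSpace ℝ (Fin 1)).1
          (v : E × EuclideanSpace ℝ (Fin 1)).1 := by
        by_cases h0 : (v : E × EuclideanSpace ℝ (Fin 1)).1 = 0
        · rw [h0, map_zero]
        · exact (h.pos p.1 _ h0).le
      have h2 := mul_nonneg (hφ0 _ (hIT p.2.2)).le h1
      have h3 : (√κ * intervalForm p.2 (v : E × EuclideanSpace ℝ (Fin 1)).2) ^ 2 =
          κ * (intervalForm p.2 (v : E × EuclideanSpace ℝ (Fin 1)).2 *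
            intervalForm p.2 (v : E × EuclideanSpace ℝ (Fin 1)).2) := by
        rw [mul_pow, Real.sq_sqrt hκ.le, sq]
      exact h3.le.trans (le_add_of_nonneg_left h2)

end Distance

/-! ### The profile of the warping -/

section Profile

/-- The warping function `cos (k s) ^ (4 / n)`. -/
def warpProfile (n k s : ℝ) : ℝ := Real.cos (k * s) ^ (4 / n)

/-- Half of the logarithmic derivative of `warpProfile`. -/
def warpLogDeriv (n k s : ℝ) : ℝ := -(2 * k / n) * Real.tan (k * s)

lemma isOpen_cos_pos (k : ℝ) : IsOpen {s : ℝ | 0 < Real.cos (k * s)} :=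
  isOpen_lt continuous_const (by fun_prop)

lemma cos_le_cos_mul {k : ℝ} (hk : 0 ≤ k) (hk' : k < Real.pi / 2) {s : ℝ} (hs : s ∈ Icc (-1 : ℝ) 1) :
    Real.cos k ≤ Real.cos (k * s) := by
  rw [← Real.cos_abs (k * s), abs_mul, abs_of_nonneg hk]
  exact Real.cos_le_cos_of_nonneg_of_le_pi (by positivity) (by linarith [Real.pi_pos])
    (mul_le_of_le_one_right hk (abs_le.2 hs))

lemma warpProfile_pos (n k : ℝ) {s : ℝ} (hs : 0 < Real.cos (k * s)) : 0 < warpProfile n k s :=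
  Real.rpow_pos_of_pos hs _

lemma contDiffOn_warpProfile (n k : ℝ) :
    ContDiffOn ℝ ∞ (warpProfile n k) {s | 0 < Real.cos (k * s)} :=
  ContDiffOn.rpow_const_of_ne (by fun_prop) fun _ hs => (mem_ofPred.1 hs).ne'

lemma hasDerivAt_warpLogDeriv (n k : ℝ) {s : ℝ} (hs : Real.cos (k * s) ≠ 0) :
    HasDerivAt (warpLogDeriv n k) (-(2 * k / n) * (1 / Real.cos (k * s) ^ 2 * k)) s := by
  have h := (Real.hasDerivAt_tan hs).comp s ((hasDerivAt_id s).const_mul k)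
  exact (h.const_mul (-(2 * k / n))).congr_deriv (by rw [mul_one])

lemma contDiffOn_warpLogDeriv (n k : ℝ) :
    ContDiffOn ℝ ∞ (warpLogDeriv n k) {s | 0 < Real.cos (k * s)} := by
  intro s hs
  have h := (Real.contDiffAt_tan (n := ∞)).2 (mem_ofPred.1 hs).ne'
  exact (contDiffAt_const.mul (h.comp s (by fun_prop))).contDiffWithinAt

lemma deriv_warpProfile (n k : ℝ) {s : ℝ} (hs : 0 < Real.cos (k * s)) :
    deriv (warpProfile n k) s = 2 * warpProfile n k s * warpLogDeriv n k s := by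
  have h1 : HasDerivAt (fun s => Real.cos (k * s)) (-Real.sin (k * s) * (k * 1)) s :=
    (Real.hasDerivAt_cos (k * s)).comp s ((hasDerivAt_id s).const_mul k)
  have h2 := h1.rpow_const (p := 4 / n) (Or.inl hs.ne')
  unfold warpProfile warpLogDeriv
  rw [h2.deriv, Real.rpow_sub_one hs.ne', Real.tan_eq_sin_div_cos]
  ring

/-- `L = warpLogDeriv` solves the Riccati equation that makes the contribution of the warping to
the scalar curvature constant. -/
lemma riccati_warpLogDeriv {n k s : ℝ} (hn : n ≠ 0) (hs : Real.cos (k * s) ≠ 0) :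
    2 * deriv (warpLogDeriv n k) s + n * warpLogDeriv n k s ^ 2 = -(4 * k ^ 2 / n) := by
  rw [(hasDerivAt_warpLogDeriv n k hs).deriv, warpLogDeriv, Real.tan_eq_sin_div_cos]
  have := Real.sin_sq (k * s)
  field_simp
  rw [this]
  ring

end Profile

end

theorem mainTheorem2 (m n : ℕ) (hn : n = m + 1)
    (Y : Type*) [TopologicalSpace Y] [T2Space Y] [SecondCountableTopology Y] [Nonempty Y]
    [ChartedSpace (EuclideanSpace ℝ (Fin m)) Y] [IsManifold (𝓡 m) ∞ Y]
    (ε : ℝ) (hε : 0 < ε) (hε' : ε < 2 * Real.pi / n) :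
    ∃ g : SmoothMetric ((𝓡 m).prod (𝓡∂ 1)) (Y × Icc (-1 : ℝ) 1),
      (∀ p : Y × Icc (-1 : ℝ) 1, (n : ℝ) * (n - 1) ≤ g.scalarCurvature (bandBasis m) p) ∧
      g.setEDist {p | (p.2 : ℝ) = -1} {p | (p.2 : ℝ) = 1}
        = ENNReal.ofReal (2 * Real.pi / n - ε) := by
  have : LocallyCompactSpace Y := ChartedSpace.locallyCompactSpace (EuclideanSpace ℝ (Fin m)) Y
  have hn0 : (0 : ℝ) < n := by
    rw [hn]
    positivity
  have hnm : (n : ℝ) = m + 1 := by exact_mod_cast hn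
  set ℓ := 2 * Real.pi / n - ε with hℓ
  have hℓ0 : 0 < ℓ := by linarith
  have hκ : 0 < (ℓ / 2) ^ 2 := by positivity
  -- The curvature condition needs `n ℓ / 4 < k`, positivity of the cosine needs `k < π / 2`.
  obtain ⟨k, hk1, hk2⟩ : ∃ k, n * ℓ / 4 < k ∧ k < Real.pi / 2 := by
    refine exists_between ?_
    have : n * ℓ < 2 * Real.pi := by
      rw [hℓ, mul_sub, mul_div_cancel₀ _ hn0.ne']
      linarith [mul_pos hn0 hε]
    linarith
  have hk0 : 0 < k := lt_trans (by positivity) hk1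
  have hck : 0 < Real.cos k := Real.cos_pos_of_mem_Ioo ⟨by linarith, hk2⟩
  have hIT : Icc (-1) 1 ⊆ {s : ℝ | 0 < Real.cos (k * s)} := fun s hs =>
    hck.trans_le (cos_le_cos_mul hk0.le hk2 hs)
  -- `m D` is the curvature left over to compensate for the negative curvature of `Y`.
  set D := 4 * k ^ 2 / (n * (ℓ / 2) ^ 2) - n with hD
  have hD0 : 0 < D := by
    rw [hD, sub_pos, lt_div_iff₀ (by positivity)]
    nlinarith [mul_pos hn0 hℓ0]
  set φ₀ := Real.cos k ^ (4 / (n : ℝ)) with hφ₀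
  have hφ₀0 : 0 < φ₀ := Real.rpow_pos_of_pos hck _
  obtain ⟨h, hh⟩ := exists_metric_neg_le_scalarCurvature (I := 𝓡 m) (M := Y)
    (EuclideanSpace.basisFun (Fin m) ℝ).toBasis (mul_pos hD0 hφ₀0)
  refine ⟨h.band (isOpen_cos_pos k) hIT (contDiffOn_warpProfile n k)
    (fun s hs => warpProfile_pos n k hs) hκ, fun p => ?_, ?_⟩
  · have hcos := hIT p.2.2
    have hφ : φ₀ ≤ warpProfile n k p.2 :=
      Real.rpow_le_rpow hck.le (cos_le_cos_mul hk0.le hk2 p.2.2) (by positivity)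
    refine le_of_le_of_eq ?_ (h.scalarCurvature_band _ (isOpen_cos_pos k) hIT _ _ hκ
      (contDiffOn_warpLogDeriv n k) (fun s hs => deriv_warpProfile n k hs) p).symm
    rw [Fintype.card_fin, ← hnm, riccati_warpLogDeriv hn0.ne' (mem_ofPred.1 hcos).ne']
    have e : (m : ℝ) / (ℓ / 2) ^ 2 * -(4 * k ^ 2 / n) = -(m * (D + n)) := by
      rw [hD]
      field_simp
      ring
    rw [e]
    have hSc : -(m * D) ≤ h.scalarCurvature (EuclideanSpace.basisFun (Fin m) ℝ).toBasis p.1 /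
        warpProfile n k p.2 := by
      rcases Nat.eq_zero_or_pos m with rfl | hm
      · -- In dimension zero the scalar curvature is an empty sum.
        simp [SmoothMetric.scalarCurvature, coordScalarCurvature]
      · have h1 : (1 : ℝ) ≤ m := by exact_mod_cast hm
        rw [le_div_iff₀ (hφ₀0.trans_le hφ)]
        refine le_trans ?_ (hh p.1)
        have h2 : D * φ₀ ≤ D * warpProfile n k p.2 := mul_le_mul_of_nonneg_left hφ hD0.le
        have h3 : 0 ≤ D * warpProfile n k p.2 := mul_nonneg hD0.le (hφ₀0.trans_le hφ).le
        nlinarith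
    have h4 : (n : ℝ) * (n - 1) = n * m := by
      rw [hnm]
      ring
    rw [h4]
    linarith
  · rw [SmoothMetric.setEDist_band, Real.sqrt_sq (by positivity)]
    congr 1
    ring
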